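/- Let $\mathbf X$ be a standard Borel space, $\mathbf Z=\mathbf X\times\mathbb R$, and let $U$ be the uniform probability measure on $[0,1]$. An *extended observation* is a pair $(z,\theta)$ with $z=(x,y)\in\mathbf Z$ ($x$ the predictor, $y$ the response) and $\theta\in[0,1]$. **Definitions.** A *randomized conformity measure* is a measurable function $A:\bigcup_{n\ge1}(\mathbf Z\times[0,1])^{n+1}\to\mathbb R$ that is invariant under permutations of its first $n$ arguments. For $n\ge1$, extended training observations $\zeta_1,\dots,\zeta_n$ and an extended test observation $\zeta_{n+1}=((x_{n+1},y),\theta_{n+1})$, put $\alpha_i^y=A(\zeta_1,\dots,\zeta_{i-1},\zeta_{i+1},\dots,\zeta_{n+1},\zeta_i)$ for $i=1,\dots,n+1$. The *conformal transducer* of $A$ is $$Q(\zeta_1,\dots,\zeta_n,\zeta_{n+1},\tau)=\frac{1}{n+1}\bigl|\{i\le n+1:\alpha_i^y<\alpha_{n+1}^y\}\bigr|+\frac{\tau}{n+1}\bigl|\{i\le n+1:\alpha_i^y=\alpha_{n+1}^y\}\bigr|,\qquad \tau\in[0,1].$$ A measurable function $Q:\bigcup_{n\ge1}\bigl((\mathbf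 Z\times[0,1])^{n+1}\times[0,1]\bigr)\to[0,1]$ is a *randomized predictive system* if for every $n\ge1$: - for all $\zeta_1,\dots,\zeta_n$, $x_{n+1}$, $\theta_{n+1}$, the function $Q(\zeta_1,\dots,\zeta_n,((x_{n+1},y),\theta_{n+1}),\tau)$ is non-decreasing in $y$ for each $\tau$ and in $\tau$ for each $y$, tends to $0$ as $y\to-\infty$ when $\tau=0$, and tends to $1$ as $y\to\infty$ when $\tau=1$; - for every probability measure $P$ on $\mathbf Z$, if $\zeta_1,\dots,\zeta_{n+1}\sim P\times U$ and $\tau\sim U$ are independent, then $\mathbb P\bigl(Q(\zeta_1,\dots,\zeta_{n+1},\tau)\le\alpha\bigr)=\alpha$ for all $\alpha\in[0,1]$. A *conformal predictive system* is a randomized predictive system that is the conformal transducer of some randomized conformity measure. A randomized predictive system $Q$ is *universally consistent* if for every probability measure $P$ on $\mathbf Z$ and every bounded continuous $f:\mathbb R\to\mathbb R$, $$\int f\,dQ_n-\mathbb E_P(f\mid x_{n+1})\to0\quad(n\to\infty)\quad\text{in probability,}$$ where $\zeta_i=((x_i,y_i),\theta_i)\sim P\times U$, $i=1,\dots,n+1$,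 and $\tau\sim U$ are independent, $Q_n(y)=Q(\zeta_1,\dots,\zeta_n,((x_{n+1},y),\theta_{n+1}),\tau)$, the integral is with respect to the measure on $\mathbb R$ that assigns mass $Q_n(v+)-Q_n(u+)$ to each interval $(u,v]$, and $\mathbb E_P(f\mid x_{n+1})$ is the conditional expectation of $f(y)$ given $x=x_{n+1}$ under $(x,y)\sim P$. Let $e$ be a Borel isomorphism of $\mathbf X$ onto a Borel subset of $\mathbb R$, and let $(h_n)$ be a non-increasing sequence of powers $2^k$, $k\in\mathbb Z$, with $h_n\to0$ and $nh_n\to\infty$. Two predictors are in the same cell at level $n$ if their images under $e$ lie in the same interval $[kh_n,(k+1)h_n)$, $k\in\mathbb Z$. The *histogram conformity measure* of $(e,(h_n))$ assigns to $((x_1,y_1),\theta_1),\dots,((x_{n+1},y_{n+1}),\theta_{n+1})$ the value $a/N$, where $N$ is the number of $i\le n$ such that $x_i$ is in the cell of $x_{n+1}$ at level $n$, and $a$ is the number of those $i$ for which also $y_i<y_{n+1}$, or $y_i=y_{n+1}$ and $\theta_i\le\theta_{n+1}$; if $N=0$, the value is $1$ when $y_{n+1}\ge0$ and $0$ otherwise.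 **Theorem.** There exists a universally consistent conformal predictive system. Moreover, for every such $e$ and $(h_n)$, the histogram conformity measure is a randomized conformity measure, and its conformal transducer is a universally consistent conformal predictive system. -/

import Mathlib

open Filter Topology MeasureTheory

namespace ConformalPrediction

/-- Extended observations `((x, y), θ)`: an observation `(x, y) ∈ X × ℝ` (predictor, response)
together with a number `θ ∈ [0, 1]` used for tie-breaking. -/
abbrev ExtObs (X : Type*) : Type _ := (X × ℝ) × unitInterval

/-- The joint law of `n` extended training observations, an extended test observation and `τ`,
all independent, where observations are drawn from `P` and `τ` and all `θ` are uniform on `[0, 1]`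
(`volume` on `unitInterval` is the uniform probability measure). -/
noncomputable def law {X : Type*} [MeasurableSpace X] (P : Measure (X × ℝ)) (n : ℕ) :
    Measure ((Fin n → ExtObs X) × ExtObs X × unitInterval) :=
  (Measure.pi fun _ : Fin n => P.prod (volume : Measure unitInterval)).prod
    ((P.prod (volume : Measure unitInterval)).prod (volume : Measure unitInterval))

/-- Randomized predictive systems (for extended predictors `(x, θ)`), as functions
`Q n (z₁, …, zₙ) zₙ₊₁ τ`; only the values for `n ≥ 1` are relevant. -/
structure IsRandomizedPredictiveSystem {X : Type*} [MeasurableSpace X]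
    (Q : (n : ℕ) → (Fin n → ExtObs X) → ExtObs X → unitInterval → ℝ) : Prop where
  measurable : ∀ n, 1 ≤ n →
    Measurable fun p : (Fin n → ExtObs X) × ExtObs X × unitInterval => Q n p.1 p.2.1 p.2.2
  mem_Icc : ∀ n, 1 ≤ n → ∀ z w τ, Q n z w τ ∈ Set.Icc (0 : ℝ) 1
  monotone_response : ∀ n, 1 ≤ n → ∀ (z : Fin n → ExtObs X) (x : X) (θ τ : unitInterval),
    Monotone fun y : ℝ => Q n z ((x, y), θ) τ
  monotone_tau : ∀ n, 1 ≤ n → ∀ (z : Fin n → ExtObs X) (w : ExtObs X), Monotone (Q n z w)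
  tendsto_atBot : ∀ n, 1 ≤ n → ∀ (z : Fin n → ExtObs X) (x : X) (θ : unitInterval),
    Tendsto (fun y : ℝ => Q n z ((x, y), θ) 0) atBot (𝓝 0)
  tendsto_atTop : ∀ n, 1 ≤ n → ∀ (z : Fin n → ExtObs X) (x : X) (θ : unitInterval),
    Tendsto (fun y : ℝ => Q n z ((x, y), θ) 1) atTop (𝓝 1)
  uniform : ∀ n, 1 ≤ n → ∀ P : Measure (X × ℝ), IsProbabilityMeasure P →
    ∀ α ∈ Set.Icc (0 : ℝ) 1, law P n {p | Q n p.1 p.2.1 p.2.2 ≤ α} = ENNReal.ofReal α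

/-- The measure on `ℝ` giving each interval `(u, v]` the mass `G(v+) - G(u+)`, for a monotone
function `G` (and, by convention, the zero measure if `G` is not monotone). -/
noncomputable def predictiveMeasure (G : ℝ → ℝ) : Measure ℝ :=
  open scoped Classical in
  if hG : Monotone G then hG.stieltjesFunction.measure else 0

/-- `E_P(f | x)`: the conditional expectation of `f(y)` given the predictor `x` under
`(x, y) ∼ P`; it is a function on `X × ℝ` measurable with respect to the first coordinate. -/
noncomputable def condExpGivenPredictor {X : Type*} [MeasurableSpace X] (P : Measure (X × ℝ))
    (f : ℝ → ℝ) : X × ℝ → ℝ :=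
  P[fun z : X × ℝ => f z.2 | MeasurableSpace.comap (Prod.fst : X × ℝ → X) inferInstance]

/-- `Q` is consistent for `P`: for every bounded continuous `f`, `∫ f dQₙ - E_P(f | xₙ₊₁) → 0` in
probability, where `Qₙ` is the predictive distribution function `y ↦ Q(z₁, …, zₙ, (xₙ₊₁, y), τ)`. -/
def IsConsistent {X : Type*} [MeasurableSpace X]
    (Q : (n : ℕ) → (Fin n → ExtObs X) → ExtObs X → unitInterval → ℝ)
    (P : Measure (X × ℝ)) : Prop :=
  ∀ f : ℝ → ℝ, Continuous f → (∃ C : ℝ, ∀ y, |f y| ≤ C) → ∀ ε : ℝ, 0 < ε →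
    Tendsto
      (fun n : ℕ => law P n {p |
        ε ≤ |(∫ y, f y ∂predictiveMeasure fun y => Q n p.1 ((p.2.1.1.1, y), p.2.1.2) p.2.2)
          - condExpGivenPredictor P f p.2.1.1|})
      atTop (𝓝 0)

/-- Consistency for every probability measure on the observation space. -/
def IsUniversallyConsistent {X : Type*} [MeasurableSpace X]
    (Q : (n : ℕ) → (Fin n → ExtObs X) → ExtObs X → unitInterval → ℝ) : Prop :=
  ∀ P : Measure (X × ℝ), IsProbabilityMeasure P → IsConsistent Q P

/-- Randomized conformity measures `A n (z₁, …, zₙ) zₙ₊₁`. -/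
structure IsRandomizedConformityMeasure {X : Type*} [MeasurableSpace X]
    (A : (n : ℕ) → (Fin n → ExtObs X) → ExtObs X → ℝ) : Prop where
  measurable : ∀ n, 1 ≤ n → Measurable fun p : (Fin n → ExtObs X) × ExtObs X => A n p.1 p.2
  perm_invariant : ∀ n, 1 ≤ n → ∀ (z : Fin n → ExtObs X) (w : ExtObs X)
    (σ : Equiv.Perm (Fin n)), A n (fun i => z (σ i)) w = A n z w

/-- The conformity score of the `i`th element of the augmented sequence `(z₁, …, zₙ, w)`:
`A` evaluated with the other elements of the sequence, in their order, as comparison data. -/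
def conformityScore {X : Type*} (A : (n : ℕ) → (Fin n → ExtObs X) → ExtObs X → ℝ) (n : ℕ)
    (z : Fin n → ExtObs X) (w : ExtObs X) (i : Fin (n + 1)) : ℝ :=
  let s : Fin (n + 1) → ExtObs X := Fin.snoc z w
  A n (fun j => s (i.succAbove j)) (s i)

/-- The conformal transducer corresponding to `A`. -/
noncomputable def conformalTransducer {X : Type*}
    (A : (n : ℕ) → (Fin n → ExtObs X) → ExtObs X → ℝ)
    (n : ℕ) (z : Fin n → ExtObs X) (w : ExtObs X) (τ : unitInterval) : ℝ :=
  1 / (n + 1 : ℝ) * (Finset.univ.filter fun i : Fin (n + 1) =>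
      conformityScore A n z w i < conformityScore A n z w (Fin.last n)).card
  + (τ : ℝ) / (n + 1 : ℝ) * (Finset.univ.filter fun i : Fin (n + 1) =>
      conformityScore A n z w i = conformityScore A n z w (Fin.last n)).card

/-- `Q` is (for `n ≥ 1`) the conformal transducer of some randomized conformity measure. -/
def IsConformalTransducer {X : Type*} [MeasurableSpace X]
    (Q : (n : ℕ) → (Fin n → ExtObs X) → ExtObs X → unitInterval → ℝ) : Prop :=
  ∃ A : (n : ℕ) → (Fin n → ExtObs X) → ExtObs X → ℝ,
    IsRandomizedConformityMeasure A ∧ ∀ n, 1 ≤ n → Q n = conformalTransducer A n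

/-- A conformal predictive system is both a conformal transducer and a randomized predictive
system. -/
def IsConformalPredictiveSystem {X : Type*} [MeasurableSpace X]
    (Q : (n : ℕ) → (Fin n → ExtObs X) → ExtObs X → unitInterval → ℝ) : Prop :=
  IsConformalTransducer Q ∧ IsRandomizedPredictiveSystem Q

/-- Admissible cell widths: a (weakly) decreasing sequence of powers of 2 with `hₙ → 0` and
`n hₙ → ∞`. -/
structure IsBandwidth (h : ℕ → ℝ) : Prop where
  antitone : Antitone h
  power_of_two : ∀ n, ∃ k : ℤ, h n = (2 : ℝ) ^ k
  tendsto_zero : Tendsto h atTop (𝓝 0)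
  tendsto_mul_atTop : Tendsto (fun n : ℕ => (n : ℝ) * h n) atTop atTop

/-- `x` and `x'` are in the same cell `[k hₙ, (k + 1) hₙ)`, `k ∈ ℤ`, of the partition of `X`, where
`X` is identified with a Borel subset of `ℝ` by means of `e`. -/
def SameCell {X : Type*} (e : X → ℝ) (h : ℕ → ℝ) (n : ℕ) (x x' : X) : Prop :=
  ∃ k : ℤ, e x ∈ Set.Ico (k * h n) ((k + 1) * h n) ∧ e x' ∈ Set.Ico (k * h n) ((k + 1) * h n)

/-- The histogram conformity measure: the lexicographic rank of the test response among the
responses of the comparison data in the cell of the test predictor, divided by their number. -/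
noncomputable def histogramConformityMeasure {X : Type*} (e : X → ℝ) (h : ℕ → ℝ) (n : ℕ)
    (z : Fin n → ExtObs X) (w : ExtObs X) : ℝ :=
  open scoped Classical in
  let N : ℕ := (Finset.univ.filter fun i : Fin n => SameCell e h n (z i).1.1 w.1.1).card
  let a : ℕ := (Finset.univ.filter fun i : Fin n => SameCell e h n (z i).1.1 w.1.1 ∧
    ((z i).1.2 < w.1.2 ∨ ((z i).1.2 = w.1.2 ∧ (z i).2 ≤ w.2))).card
  if N = 0 then (if 0 ≤ w.1.2 then 1 else 0) else (a : ℝ) / (N : ℝ)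

end ConformalPrediction

/-! Exact uniformity rests on exchangeability alone. For a fixed augmented sequence and uniform `τ`,
the probability that the smoothed rank of the `i`th score is at most `α` has average exactly `α`
over `i`: the rank intervals of the tied blocks tile the unit interval
(`sum_volume_smoothedRank_le`). Permutation invariance makes all positions equally distributed, so
each of these probabilities, after integrating over the sequence, is `α`. Monotonicity in the
response holds for the histogram measure because raising the test response raises its own score and
can only lower the others.

Consistency holds because the transducer hardly changes the histogram score. When the lexicographic
keys are distinct, the scores in a cell with `K ≥ 2` members are exactly `j / (K - 1)`, `j < K`, so
about a fraction `u` of them lies below `u`, whatever the responses are. Summed over cells, the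
smoothed rank of the test score equals that score up to the number of occupied cells divided by `n +
1` (`abs_smoothedRank_sub_le`), and the score is the empirical distribution function of the
responses in the test cell.

As `n h_n → ∞`, there are `o(n)` occupied cells, and the expected count of the test cell tends to
infinity in probability; Chebyshev's inequality then replaces the empirical distribution function by
the conditional probability of `y ≤ t` given the cell. Widths that are powers of two give nested
cells, so these conditional probabilities form a martingale; since `h_n → 0`, Lévy's upward theorem
identifies the limit as the conditional distribution function given the predictor. Convergence at
the points of a finite grid, with a tail bound, yields convergence of integrals
(`abs_integral_sub_integral_le`). -/

namespace ConformalPrediction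

/-! ### Smoothed ranks and exact uniformity of conformal transducers -/

/-- The randomized relative rank of the `i`th entry of a finite sequence. -/
noncomputable def smoothedRank {n : ℕ} (a : Fin (n + 1) → ℝ) (i : Fin (n + 1)) (τ : ℝ) : ℝ :=
  1 / (n + 1 : ℝ) * (Finset.univ.filter fun j => a j < a i).card
  + τ / (n + 1 : ℝ) * (Finset.univ.filter fun j => a j = a i).card

theorem conformalTransducer_eq_smoothedRank {X : Type*}
    (A : (n : ℕ) → (Fin n → ExtObs X) → ExtObs X → ℝ) (n : ℕ) (z : Fin n → ExtObs X)
    (w : ExtObs X) (τ : unitInterval) :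
    conformalTransducer A n z w τ = smoothedRank (conformityScore A n z w) (Fin.last n) τ := rfl

theorem card_lt_add_card_eq_le {ι : Type*} (s : Finset ι) (a : ι → ℝ) (u : ℝ) :
    (s.filter fun j => a j < u).card + (s.filter fun j => a j = u).card ≤ s.card := by
  classical
  rw [← Finset.card_union_of_disjoint]
  · exact Finset.card_le_card (Finset.union_subset (Finset.filter_subset _ _)
      (Finset.filter_subset _ _))
  · rw [Finset.disjoint_filter]
    intro j _ h1 h2
    exact absurd h2 h1.ne

theorem smoothedRank_mem_Icc {n : ℕ} (a : Fin (n + 1) → ℝ) (i : Fin (n + 1)) {τ : ℝ}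
    (hτ : τ ∈ Set.Icc (0 : ℝ) 1) : smoothedRank a i τ ∈ Set.Icc (0 : ℝ) 1 := by
  have hn : (0 : ℝ) < n + 1 := by positivity
  have h := card_lt_add_card_eq_le Finset.univ a (a i)
  rw [Finset.card_univ, Fintype.card_fin] at h
  have h' : ((Finset.univ.filter fun j => a j < a i).card : ℝ)
    + (Finset.univ.filter fun j => a j = a i).card ≤ n + 1 := by exact_mod_cast h
  obtain ⟨h0, h1⟩ := hτ
  constructor
  · unfold smoothedRank; positivity
  · have : smoothedRank a i τ = ((Finset.univ.filter fun j => a j < a i).card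
      + τ * (Finset.univ.filter fun j => a j = a i).card) / (n + 1) := by
      unfold smoothedRank; ring
    rw [this, div_le_one hn]
    refine le_trans ?_ h'
    gcongr
    exact mul_le_of_le_one_left (by positivity) h1

theorem smoothedRank_mono {n : ℕ} (a : Fin (n + 1) → ℝ) (i : Fin (n + 1)) :
    Monotone (smoothedRank a i) := by
  intro τ τ' h
  unfold smoothedRank
  gcongr

theorem measurable_snoc {E : Type*} [MeasurableSpace E] {n : ℕ} (k : Fin (n + 1)) :
    Measurable fun p : (Fin n → E) × E => (Fin.snoc p.1 p.2 : Fin (n + 1) → E) k := by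
  refine Fin.lastCases ?_ (fun i => ?_) k
  · simpa using measurable_snd
  · simp only [Fin.snoc_castSucc]
    exact (measurable_pi_apply i).comp measurable_fst

/-- The conformity score of the `i`th element of a sequence with respect to the others. -/
def seqScore {X : Type*} (A : (n : ℕ) → (Fin n → ExtObs X) → ExtObs X → ℝ) {n : ℕ}
    (s : Fin (n + 1) → ExtObs X) (i : Fin (n + 1)) : ℝ :=
  A n (fun j => s (i.succAbove j)) (s i)

variable {X : Type*} [MeasurableSpace X] {A : (n : ℕ) → (Fin n → ExtObs X) → ExtObs X → ℝ}

theorem IsRandomizedConformityMeasure.measurable_seqScore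
    (hA : IsRandomizedConformityMeasure A) {n : ℕ} (hn : 1 ≤ n) (i : Fin (n + 1)) :
    Measurable fun s : Fin (n + 1) → ExtObs X => seqScore A s i := by
  have h : Measurable fun s : Fin (n + 1) → ExtObs X => ((fun j => s (i.succAbove j)), s i) :=
    (measurable_pi_lambda _ fun j => measurable_pi_apply _).prodMk (measurable_pi_apply i)
  exact (hA.measurable n hn).comp h

theorem measurable_smoothedRank {n : ℕ} {Ω : Type*} [MeasurableSpace Ω]
    {a : Ω → Fin (n + 1) → ℝ} (ha : ∀ i, Measurable fun ω => a ω i) {t : Ω → ℝ}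
    (ht : Measurable t) (i : Fin (n + 1)) : Measurable fun ω => smoothedRank (a ω) i (t ω) := by
  unfold smoothedRank
  simp only [Finset.card_filter, Nat.cast_sum]
  refine (Measurable.const_mul (Finset.measurable_sum _ fun j _ => ?_) _).add
    ((ht.div_const _).mul (Finset.measurable_sum _ fun j _ => ?_))
  · exact measurable_from_top.comp
      (Measurable.ite (measurableSet_lt (ha j) (ha i)) (measurable_const (a := (1 : ℕ)))
        measurable_const)
  · exact measurable_from_top.comp
      (Measurable.ite (measurableSet_eq_fun (ha j) (ha i)) (measurable_const (a := (1 : ℕ)))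
        measurable_const)

theorem IsRandomizedConformityMeasure.measurable_conformalTransducer
    (hA : IsRandomizedConformityMeasure A) {n : ℕ} (hn : 1 ≤ n) :
    Measurable fun p : (Fin n → ExtObs X) × ExtObs X × unitInterval =>
      conformalTransducer A n p.1 p.2.1 p.2.2 := by
  simp only [conformalTransducer_eq_smoothedRank]
  refine measurable_smoothedRank (fun i => ?_) (measurable_subtype_coe.comp
    (measurable_snd.comp measurable_snd)) _
  refine (hA.measurable_seqScore hn i).comp (measurable_pi_lambda _ fun k => ?_)
  exact (measurable_snoc k).comp (measurable_fst.prodMk (measurable_fst.comp measurable_snd))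

/-- Deleting position `j` from the permuted sequence leaves the same comparison data as deleting
position `σ j` from the original, in another order, and `A` ignores the order. -/
theorem IsRandomizedConformityMeasure.seqScore_comp_perm
    (hA : IsRandomizedConformityMeasure A) {n : ℕ} (hn : 1 ≤ n)
    (s : Fin (n + 1) → ExtObs X) (σ : Equiv.Perm (Fin (n + 1))) (j : Fin (n + 1)) :
    seqScore A (s ∘ σ) j = seqScore A s (σ j) := by
  -- `σ` restricted to the complement of `j`, with both complements renumbered by `Fin n`.
  let π : Equiv.Perm (Fin n) := (finSuccAboveEquiv j).trans
    ((σ.subtypeEquiv (p := fun x => x ≠ j) (q := fun x => x ≠ σ j)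
      (fun x => by simp)).trans (finSuccAboveEquiv (σ j)).symm)
  have hπ : ∀ k, (σ j).succAbove (π k) = σ (j.succAbove k) := by
    intro k
    have := (finSuccAboveEquiv (σ j)).apply_symm_apply (σ.subtypeEquiv (p := fun x => x ≠ j)
      (q := fun x => x ≠ σ j) (fun x => by simp) (finSuccAboveEquiv j k))
    exact congrArg Subtype.val this
  unfold seqScore
  rw [← hA.perm_invariant n hn (fun k => s ((σ j).succAbove k)) (s (σ j)) π]
  simp only [hπ, Function.comp]

theorem smoothedRank_comp_perm {n : ℕ} (a : Fin (n + 1) → ℝ) (σ : Equiv.Perm (Fin (n + 1)))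
    (i : Fin (n + 1)) (τ : ℝ) : smoothedRank (a ∘ σ) i τ = smoothedRank a (σ i) τ := by
  have h : ∀ p : ℝ → Prop, ∀ [DecidablePred p],
      (Finset.univ.filter fun j => p ((a ∘ σ) j)).card = (Finset.univ.filter fun j => p (a j)).card :=
    fun p _ => Finset.card_bij (fun j _ => σ j) (by simp) (by simp)
      fun b hb => ⟨σ.symm b, by simpa using hb, by simp⟩
  unfold smoothedRank
  rw [h fun x => x < (a ∘ σ) i, h fun x => x = (a ∘ σ) i]
  rfl

/-- The intervals `(L v, L v + E v]`, where `L v` and `E v` count the entries below `v` and equal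
to `v`, tile `(0, |s|]`. -/
theorem sum_clamp_rank {ι : Type*} (a : ι → ℝ) {c : ℝ} (hc : 0 ≤ c) (s : Finset ι) :
    ∑ i ∈ s, min 1 (max 0 ((c - (s.filter fun j => a j < a i).card)
      / (s.filter fun j => a j = a i).card)) = min c s.card := by
  induction s using Finset.strongInduction with
  | H s ih =>
  rcases s.eq_empty_or_nonempty with rfl | hs
  · simp [hc]
  obtain ⟨m, hm, hmax⟩ := s.exists_max_image a hs
  -- Peel off the block `G` of maximal entries. Removing it does not affect the counts below or at
  -- any entry of `s'`, so induction applies to `s'`.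
  set s' := s.filter fun j => a j < a m with hs'
  set G := s.filter fun j => ¬ a j < a m with hG
  have hcard : s'.card + G.card = s.card := Finset.card_filter_add_card_filter_not _
  have hmG : m ∈ G := by simp [hG, hm]
  have hGpos : 0 < G.card := Finset.card_pos.2 ⟨m, hmG⟩
  have hsub : s' ⊂ s := by
    refine Finset.filter_ssubset.2 ⟨m, hm, lt_irrefl _⟩
  rw [← Finset.sum_filter_add_sum_filter_not s (fun j => a j < a m)]
  have h1 : ∑ i ∈ s', min 1 (max 0 ((c - (s.filter fun j => a j < a i).card)
      / (s.filter fun j => a j = a i).card)) = min c s'.card := by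
    rw [← ih s' hsub]
    refine Finset.sum_congr rfl fun i hi => ?_
    have him := (Finset.mem_filter.1 hi).2
    have e1 : s.filter (fun j => a j < a i) = s'.filter fun j => a j < a i := by
      ext j; simp only [hs', Finset.mem_filter]
      exact ⟨fun h => ⟨⟨h.1, h.2.trans him⟩, h.2⟩, fun h => ⟨h.1.1, h.2⟩⟩
    have e2 : s.filter (fun j => a j = a i) = s'.filter fun j => a j = a i := by
      ext j; simp only [hs', Finset.mem_filter]
      exact ⟨fun h => ⟨⟨h.1, h.2 ▸ him⟩, h.2⟩, fun h => ⟨h.1.1, h.2⟩⟩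
    rw [e1, e2]
  have h2 : ∑ i ∈ G, min 1 (max 0 ((c - (s.filter fun j => a j < a i).card)
      / (s.filter fun j => a j = a i).card))
      = G.card * min 1 (max 0 ((c - s'.card) / G.card)) := by
    rw [← nsmul_eq_mul, ← Finset.sum_const]
    refine Finset.sum_congr rfl fun i hi => ?_
    have hi' := Finset.mem_filter.1 hi
    have him : a i = a m := le_antisymm (hmax i hi'.1) (not_lt.1 hi'.2)
    have e2 : s.filter (fun j => a j = a i) = G := by
      ext j; simp only [hG, Finset.mem_filter, him]
      exact ⟨fun h => ⟨h.1, h.2 ▸ lt_irrefl _⟩,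
        fun h => ⟨h.1, le_antisymm (hmax j h.1) (not_lt.1 h.2)⟩⟩
    rw [e2, him]
  rw [h1, h2]
  have hGr : (0 : ℝ) < G.card := by exact_mod_cast hGpos
  have hcr : (s.card : ℝ) = s'.card + G.card := by exact_mod_cast hcard.symm
  rw [hcr]
  -- Every member of `G` has the same summand, so `G` contributes the length of the part of `(|s'|,
  -- |s'| + |G|]` below `c`.
  rcases le_total c s'.card with h | h
  · rw [max_eq_left (div_nonpos_of_nonpos_of_nonneg (by linarith) hGr.le), min_eq_left h,
      min_eq_left (show c ≤ s'.card + G.card by linarith)]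
    simp
  · rw [max_eq_right (div_nonneg (by linarith) hGr.le), min_eq_right h]
    rcases le_total c (s'.card + G.card) with h' | h'
    · rw [min_eq_right ((div_le_one hGr).2 (by linarith)), min_eq_left h']
      field_simp
      ring
    · rw [min_eq_left ((one_le_div hGr).2 (by linarith)), min_eq_right h']
      ring

theorem volume_unitInterval_le (u : ℝ) :
    (volume : Measure unitInterval) {τ | (τ : ℝ) ≤ u} = ENNReal.ofReal (min 1 (max 0 u)) := by
  rcases lt_or_ge u 0 with h | h
  · have : {τ : unitInterval | (τ : ℝ) ≤ u} = ∅ := by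
      ext τ; simpa using h.trans_le τ.2.1
    rw [this, max_eq_left h.le]; simp
  rw [max_eq_right h]
  have hx : min 1 u ∈ unitInterval := ⟨le_min zero_le_one h, min_le_left _ _⟩
  have : {τ : unitInterval | (τ : ℝ) ≤ u} = Set.Iic ⟨min 1 u, hx⟩ := by
    ext τ
    simp only [Set.mem_ofPred_eq, Set.mem_Iic, ← Subtype.coe_le_coe, le_min_iff]
    exact ⟨fun h => ⟨τ.2.2, h⟩, fun h => h.2⟩
  rw [this, unitInterval.volume_Iic]

/-- The deterministic core of validity: solving for `τ` turns each event into `τ ≤ (c - L) / E` with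
`c = (n + 1) α`, and `sum_clamp_rank` adds up the clamped bounds. Ties need no separate treatment.
-/
theorem sum_volume_smoothedRank_le {n : ℕ} (a : Fin (n + 1) → ℝ) {α : ℝ}
    (hα : α ∈ Set.Icc (0 : ℝ) 1) :
    ∑ i, (volume : Measure unitInterval) {τ | smoothedRank a i τ ≤ α}
      = (n + 1 : ℕ) * ENNReal.ofReal α := by
  have hn : (0 : ℝ) < n + 1 := by positivity
  have key : ∀ i, {τ : unitInterval | smoothedRank a i τ ≤ α}
      = {τ : unitInterval | (τ : ℝ) ≤ ((n + 1) * α - (Finset.univ.filter fun j => a j < a i).card)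
        / (Finset.univ.filter fun j => a j = a i).card} := by
    intro i
    ext τ
    have hE : (0 : ℝ) < (Finset.univ.filter fun j => a j = a i).card := by
      exact_mod_cast Finset.card_pos.2 ⟨i, by simp⟩
    simp only [Set.mem_ofPred_eq, smoothedRank]
    rw [le_div_iff₀ hE, one_div, inv_mul_eq_div, div_mul_eq_mul_div, ← add_div, div_le_iff₀ hn]
    constructor <;> intro h <;> linarith
  simp only [key, volume_unitInterval_le]
  rw [← ENNReal.ofReal_sum_of_nonneg fun i _ => le_min zero_le_one (le_max_left _ _),
    sum_clamp_rank a (by have := hα.1; positivity) Finset.univ, Finset.card_univ, Fintype.card_fin,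
    min_eq_left, ENNReal.ofReal_mul hn.le]
  · congr 1
    rw [← ENNReal.ofReal_natCast]; push_cast; rfl
  · push_cast
    nlinarith [hα.2]

theorem measurePreserving_snoc {E : Type*} [MeasurableSpace E] (μ : Measure E) [SigmaFinite μ]
    (n : ℕ) : MeasurePreserving (fun p : (Fin n → E) × E => (Fin.snoc p.1 p.2 : Fin (n + 1) → E))
      ((Measure.pi fun _ => μ).prod μ) (Measure.pi fun _ => μ) := by
  have h1 := (measurePreserving_piFinSuccAbove (fun _ : Fin (n + 1) => μ) (Fin.last n)).symm
  have h2 := h1.comp (Measure.measurePreserving_swap (μ := Measure.pi fun _ : Fin n => μ) (ν := μ))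
  convert h2 using 1
  ext p k
  simp [MeasurableEquiv.piFinSuccAbove, Fin.insertNthEquiv]

/-- Conformal transducers are exactly uniform under the randomness assumption. -/
theorem IsRandomizedConformityMeasure.law_conformalTransducer_le
    (hA : IsRandomizedConformityMeasure A) {n : ℕ} (hn : 1 ≤ n) (P : Measure (X × ℝ))
    [IsProbabilityMeasure P] {α : ℝ} (hα : α ∈ Set.Icc (0 : ℝ) 1) :
    law P n {p | conformalTransducer A n p.1 p.2.1 p.2.2 ≤ α} = ENNReal.ofReal α := by
  set μ : Measure (ExtObs X) := P.prod volume with hμ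
  set ν : Measure (Fin (n + 1) → ExtObs X) := Measure.pi fun _ => μ with hν
  let S : Fin (n + 1) → Set ((Fin (n + 1) → ExtObs X) × unitInterval) := fun i =>
    {q | smoothedRank (seqScore A q.1) i q.2 ≤ α}
  have hS : ∀ i, MeasurableSet (S i) := fun i =>
    measurableSet_le (measurable_smoothedRank
      (fun j => (hA.measurable_seqScore hn j).comp measurable_fst)
      (measurable_subtype_coe.comp measurable_snd) i) measurable_const
  have hlaw : law P n {p | conformalTransducer A n p.1 p.2.1 p.2.2 ≤ α}
      = ν.prod volume (S (Fin.last n)) := by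
    have h1 := ((measurePreserving_snoc μ n).prod
      (MeasurePreserving.id (volume : Measure unitInterval))).comp
      (measurePreserving_prodAssoc (Measure.pi fun _ : Fin n => μ) μ
        (volume : Measure unitInterval)).symm
    exact h1.measure_preimage (hS _).nullMeasurableSet
  -- Exchangeability: transposing positions `i` and `Fin.last n` preserves `ν` and carries one event
  -- to the other.
  have hperm : ∀ i, ν.prod volume (S i) = ν.prod volume (S (Fin.last n)) := by
    intro i
    have h1 := (measurePreserving_piCongrLeft (fun _ : Fin (n + 1) => μ)
      (Equiv.swap i (Fin.last n))).prod (MeasurePreserving.id (volume : Measure unitInterval))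
    rw [← h1.measure_preimage (hS _).nullMeasurableSet]
    congr 1
    ext q
    have e : (MeasurableEquiv.piCongrLeft (fun _ : Fin (n + 1) => ExtObs X)
        (Equiv.swap i (Fin.last n))) q.1 = q.1 ∘ Equiv.swap i (Fin.last n) := by
      ext1 k
      have := Equiv.piCongrLeft_apply_apply (fun _ : Fin (n + 1) => ExtObs X)
        (Equiv.swap i (Fin.last n)) q.1 (Equiv.swap i (Fin.last n) k)
      simpa [MeasurableEquiv.coe_piCongrLeft] using this
    simp only [S, Set.mem_preimage, Set.mem_ofPred_eq, Prod.map, e, id]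
    rw [show seqScore A (q.1 ∘ Equiv.swap i (Fin.last n))
      = seqScore A q.1 ∘ Equiv.swap i (Fin.last n) from
        funext fun j => hA.seqScore_comp_perm hn q.1 _ j, smoothedRank_comp_perm]
    simp
  -- Integrate over `τ` first, with the sequence fixed; the sum over `i` is then a constant.
  have hsum : ∑ i, ν.prod volume (S i) = (n + 1 : ℕ) * ENNReal.ofReal α := by
    simp only [Measure.prod_apply (hS _)]
    rw [← lintegral_finsetSum _ fun i _ => measurable_measure_prodMk_left (hS i)]
    simp only [S, Set.preimage_ofPred_eq, sum_volume_smoothedRank_le _ hα]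
    simp
  rw [hlaw]
  simp only [hperm, Finset.sum_const, Finset.card_univ, Fintype.card_fin, nsmul_eq_mul] at hsum
  exact (ENNReal.mul_right_inj (by simp) (by simp)).1 hsum

end ConformalPrediction

/-! ### The histogram conformity measure yields a conformal predictive system -/

namespace ConformalPrediction

theorem IsBandwidth.pos {h : ℕ → ℝ} (hh : IsBandwidth h) (n : ℕ) : 0 < h n := by
  obtain ⟨k, hk⟩ := hh.power_of_two n
  rw [hk]; positivity

/-- The index of the cell of `x` at level `n`. -/
noncomputable def cell {X : Type*} (e : X → ℝ) (h : ℕ → ℝ) (n : ℕ) (x : X) : ℤ := ⌊e x / h n⌋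

theorem sameCell_iff {X : Type*} {e : X → ℝ} {h : ℕ → ℝ} {n : ℕ} (hn : 0 < h n) (x x' : X) :
    SameCell e h n x x' ↔ cell e h n x = cell e h n x' := by
  have key : ∀ (k : ℤ) (u : ℝ), u ∈ Set.Ico (k * h n) ((k + 1) * h n) ↔ ⌊u / h n⌋ = k := by
    intro k u
    rw [Int.floor_eq_iff, le_div_iff₀ hn, div_lt_iff₀ hn, Set.mem_Ico]
  simp only [SameCell, key, cell]
  exact ⟨fun ⟨k, h1, h2⟩ => h1.trans h2.symm, fun h => ⟨_, h, rfl⟩⟩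

/-- The lexicographic key `(y, θ)` of an extended observation. -/
def key {X : Type*} (w : ExtObs X) : ℝ ×ₗ unitInterval := toLex (w.1.2, w.2)

theorem key_le_key {X : Type*} (w w' : ExtObs X) :
    key w ≤ key w' ↔ w.1.2 < w'.1.2 ∨ (w.1.2 = w'.1.2 ∧ w.2 ≤ w'.2) := by
  simp [key, Prod.Lex.toLex_le_toLex]

/-- The number of observations in the cell of `x`. -/
noncomputable def cellCount {X : Type*} (e : X → ℝ) (h : ℕ → ℝ) {n : ℕ} (z : Fin n → ExtObs X)
    (x : X) : ℕ :=
  (Finset.univ.filter fun i => cell e h n (z i).1.1 = cell e h n x).card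

/-- The number of observations in the cell of `w` that are lexicographically at most `w`. -/
noncomputable def cellRank {X : Type*} (e : X → ℝ) (h : ℕ → ℝ) {n : ℕ} (z : Fin n → ExtObs X)
    (w : ExtObs X) : ℕ :=
  (Finset.univ.filter fun i => cell e h n (z i).1.1 = cell e h n w.1.1 ∧ key (z i) ≤ key w).card

theorem cellRank_le_cellCount {X : Type*} (e : X → ℝ) (h : ℕ → ℝ) {n : ℕ} (z : Fin n → ExtObs X)
    (w : ExtObs X) : cellRank e h z w ≤ cellCount e h z w.1.1 :=
  Finset.card_le_card fun i hi => by
    simp only [Finset.mem_filter] at hi ⊢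
    exact ⟨hi.1, hi.2.1⟩

theorem histogramConformityMeasure_eq {X : Type*} (e : X → ℝ) {h : ℕ → ℝ} {n : ℕ} (hn : 0 < h n)
    (z : Fin n → ExtObs X) (w : ExtObs X) :
    histogramConformityMeasure e h n z w = if cellCount e h z w.1.1 = 0
      then (if 0 ≤ w.1.2 then 1 else 0) else (cellRank e h z w : ℝ) / cellCount e h z w.1.1 := by
  unfold histogramConformityMeasure cellCount cellRank
  simp only [sameCell_iff hn, key_le_key]

theorem histogramConformityMeasure_mem_Icc {X : Type*} (e : X → ℝ) {h : ℕ → ℝ} {n : ℕ}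
    (hn : 0 < h n) (z : Fin n → ExtObs X) (w : ExtObs X) :
    histogramConformityMeasure e h n z w ∈ Set.Icc (0 : ℝ) 1 := by
  rw [histogramConformityMeasure_eq e hn]
  split_ifs
  · simp
  · simp
  · exact ⟨by positivity, div_le_one_of_le₀ (by exact_mod_cast cellRank_le_cellCount e h z w)
      (by positivity)⟩

/-- Covers both roles of the test observation: as `w` its growth raises the score, as one of the
comparison data its growth lowers it. The hypothesis on responses serves the default value for an
empty cell. -/
theorem histogramConformityMeasure_mono {X : Type*} (e : X → ℝ) {h : ℕ → ℝ} {n : ℕ}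
    (hn : 0 < h n) {z z' : Fin n → ExtObs X} {w w' : ExtObs X}
    (hz : ∀ i, (z' i).1.1 = (z i).1.1) (hzk : ∀ i, key (z' i) ≤ key (z i))
    (hw : w'.1.1 = w.1.1) (hwy : w.1.2 ≤ w'.1.2) (hwk : key w ≤ key w') :
    histogramConformityMeasure e h n z w ≤ histogramConformityMeasure e h n z' w' := by
  rw [histogramConformityMeasure_eq e hn, histogramConformityMeasure_eq e hn]
  have hc : cellCount e h z' w'.1.1 = cellCount e h z w.1.1 := by simp only [cellCount, hz, hw]
  rw [hc]
  split_ifs with h0 h1 h2 h2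
  · exact le_rfl
  · exact absurd (h1.trans hwy) h2
  · exact zero_le_one
  · exact le_rfl
  · refine div_le_div_of_nonneg_right ?_ (by positivity)
    refine Nat.cast_le.2 (Finset.card_le_card fun i hi => ?_)
    simp only [Finset.mem_filter, hz, hw] at hi ⊢
    exact ⟨hi.1, hi.2.1, (hzk i).trans (hi.2.2.trans hwk)⟩

/-- Unlike the number of ties, the strict and weak counts both grow when the entry moves up relative
to the others, so this convex combination makes monotonicity visible. -/
theorem smoothedRank_eq {n : ℕ} (a : Fin (n + 1) → ℝ) (i : Fin (n + 1)) (τ : ℝ) :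
    smoothedRank a i τ = ((1 - τ) * (Finset.univ.filter fun j => a j < a i).card
      + τ * (Finset.univ.filter fun j => a j ≤ a i).card) / (n + 1) := by
  have h : (Finset.univ.filter fun j => a j ≤ a i).card
      = (Finset.univ.filter fun j => a j < a i).card
        + (Finset.univ.filter fun j => a j = a i).card := by
    rw [← Finset.card_union_of_disjoint]
    · congr 1; ext j; simp [le_iff_lt_or_eq]
    · rw [Finset.disjoint_filter]
      exact fun j _ h1 h2 => absurd h2 h1.ne
  rw [h]
  push_cast
  unfold smoothedRank
  ring

theorem smoothedRank_le_smoothedRank {n : ℕ} {a a' : Fin (n + 1) → ℝ} {i : Fin (n + 1)} {τ : ℝ}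
    (hτ : τ ∈ Set.Icc (0 : ℝ) 1) (h1 : ∀ j, a j < a i → a' j < a' i)
    (h2 : ∀ j, a j ≤ a i → a' j ≤ a' i) : smoothedRank a i τ ≤ smoothedRank a' i τ := by
  rw [smoothedRank_eq, smoothedRank_eq]
  have h1' : ((Finset.univ.filter fun j => a j < a i).card : ℝ)
      ≤ (Finset.univ.filter fun j => a' j < a' i).card :=
    Nat.cast_le.2 (Finset.card_le_card (Finset.monotone_filter_right _ fun j _ => h1 j))
  have h2' : ((Finset.univ.filter fun j => a j ≤ a i).card : ℝ)
      ≤ (Finset.univ.filter fun j => a' j ≤ a' i).card :=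
    Nat.cast_le.2 (Finset.card_le_card (Finset.monotone_filter_right _ fun j _ => h2 j))
  have := hτ.1
  have := sub_nonneg.2 hτ.2
  gcongr

theorem measurable_cell {X : Type*} [MeasurableSpace X] {e : X → ℝ} (he : Measurable e) (h : ℕ → ℝ)
    (n : ℕ) : Measurable (cell e h n) :=
  Int.measurable_floor.comp (he.div_const _)

theorem measurable_card_filter {Ω ι : Type*} [MeasurableSpace Ω] [Fintype ι] (p : ι → Ω → Prop)
    [∀ i ω, Decidable (p i ω)] (hp : ∀ i, MeasurableSet {ω | p i ω}) :
    Measurable fun ω => (Finset.univ.filter fun i => p i ω).card := by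
  simp only [Finset.card_filter]
  exact Finset.measurable_sum _ fun i _ => Measurable.ite (hp i) measurable_const measurable_const

theorem card_filter_comp_perm {ι E : Type*} [Fintype ι] (z : ι → E) (σ : Equiv.Perm ι)
    (p : E → Prop) [DecidablePred p] : (Finset.univ.filter fun i => p (z (σ i))).card
      = (Finset.univ.filter fun i => p (z i)).card :=
  Finset.card_bij (fun j _ => σ j) (by simp) (by simp)
    fun b hb => ⟨σ.symm b, by simpa using hb, by simp⟩

theorem isRandomizedConformityMeasure_histogram {X : Type*} [MeasurableSpace X] {e : X → ℝ}
    {h : ℕ → ℝ} (he : Measurable e) (hh : IsBandwidth h) :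
    IsRandomizedConformityMeasure (histogramConformityMeasure e h) where
  measurable n _ := by
    have hx : ∀ i, Measurable fun p : (Fin n → ExtObs X) × ExtObs X => p.1 i := fun i =>
      (measurable_pi_apply i).comp measurable_fst
    have hc : ∀ i, MeasurableSet {p : (Fin n → ExtObs X) × ExtObs X |
        cell e h n (p.1 i).1.1 = cell e h n p.2.1.1} := fun i =>
      measurableSet_eq_fun
        ((measurable_cell he h n).comp (measurable_fst.comp (measurable_fst.comp (hx i))))
        ((measurable_cell he h n).comp (measurable_fst.comp (measurable_fst.comp measurable_snd)))
    have hy : ∀ i, Measurable fun p : (Fin n → ExtObs X) × ExtObs X => (p.1 i).1.2 := fun i =>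
      measurable_snd.comp (measurable_fst.comp (hx i))
    have hθ : ∀ i, Measurable fun p : (Fin n → ExtObs X) × ExtObs X => (p.1 i).2 := fun i =>
      measurable_snd.comp (hx i)
    have hy' : Measurable fun p : (Fin n → ExtObs X) × ExtObs X => p.2.1.2 :=
      measurable_snd.comp (measurable_fst.comp measurable_snd)
    have hθ' : Measurable fun p : (Fin n → ExtObs X) × ExtObs X => p.2.2 :=
      measurable_snd.comp measurable_snd
    have hN : Measurable fun p : (Fin n → ExtObs X) × ExtObs X => cellCount e h p.1 p.2.1.1 :=
      measurable_card_filter _ hc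
    have ha : Measurable fun p : (Fin n → ExtObs X) × ExtObs X => cellRank e h p.1 p.2 := by
      refine measurable_card_filter _ fun i => ?_
      simp only [key_le_key]
      exact (hc i).inter ((measurableSet_lt (hy i) hy').union
        ((measurableSet_eq_fun (hy i) hy').inter 
          (measurableSet_le (measurable_subtype_coe.comp (hθ i)) (measurable_subtype_coe.comp hθ'))))
    simp only [histogramConformityMeasure_eq e (hh.pos n)]
    refine Measurable.ite (hN (measurableSet_singleton 0))
      (Measurable.ite (measurableSet_le measurable_const hy') measurable_const measurable_const) ?_
    exact (measurable_from_top.comp ha).div (measurable_from_top.comp hN)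
  perm_invariant n _ z w σ := by
    have h1 : cellCount e h (fun i => z (σ i)) w.1.1 = cellCount e h z w.1.1 :=
      card_filter_comp_perm z σ fun v => cell e h n v.1.1 = cell e h n w.1.1
    have h2 : cellRank e h (fun i => z (σ i)) w = cellRank e h z w :=
      card_filter_comp_perm z σ fun v => cell e h n v.1.1 = cell e h n w.1.1 ∧ key v ≤ key w
    rw [histogramConformityMeasure_eq e (hh.pos n), histogramConformityMeasure_eq e (hh.pos n),
      h1, h2]

theorem conformityScore_last {X : Type*} (A : (n : ℕ) → (Fin n → ExtObs X) → ExtObs X → ℝ)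
    (n : ℕ) (z : Fin n → ExtObs X) (w : ExtObs X) :
    conformityScore A n z w (Fin.last n) = A n z w := by
  simp [conformityScore]

section
variable {X : Type*} {e : X → ℝ} {h : ℕ → ℝ}

/-- The test score goes up while every training score goes down or stays, since the test observation
enters the latter with a larger key. Hence no index leaves either of the sets counted in
`smoothedRank_eq`. -/
theorem monotone_conformalTransducer_histogram (e : X → ℝ) {n : ℕ} (hn : 0 < h n)
    (z : Fin n → ExtObs X) (x : X) (θ τ : unitInterval) :
    Monotone fun y : ℝ => conformalTransducer (histogramConformityMeasure e h) n z ((x, y), θ) τ := by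
  intro y y' hy
  have hkey : key ((x, y), θ) ≤ key ((x, y'), θ) := by
    rw [key_le_key]
    rcases hy.lt_or_eq with h | h
    · exact Or.inl h
    · exact Or.inr ⟨h, le_rfl⟩
  have hlast : conformityScore (histogramConformityMeasure e h) n z ((x, y), θ) (Fin.last n)
      ≤ conformityScore (histogramConformityMeasure e h) n z ((x, y'), θ) (Fin.last n) := by
    rw [conformityScore_last, conformityScore_last]
    exact histogramConformityMeasure_mono e hn (fun _ => rfl) (fun _ => le_rfl) rfl hy hkey
  have hcast : ∀ i : Fin n,
      conformityScore (histogramConformityMeasure e h) n z ((x, y'), θ) i.castSucc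
      ≤ conformityScore (histogramConformityMeasure e h) n z ((x, y), θ) i.castSucc := by
    intro i
    have hs : ∀ j, ((Fin.snoc z ((x, y'), θ) : Fin (n + 1) → ExtObs X) j).1.1
          = ((Fin.snoc z ((x, y), θ) : Fin (n + 1) → ExtObs X) j).1.1 ∧
        key ((Fin.snoc z ((x, y), θ) : Fin (n + 1) → ExtObs X) j)
          ≤ key ((Fin.snoc z ((x, y'), θ) : Fin (n + 1) → ExtObs X) j) := by
      intro j
      refine Fin.lastCases ?_ (fun i => ?_) j
      · simpa using hkey
      · simp
    unfold conformityScore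
    simp only [Fin.snoc_castSucc]
    exact histogramConformityMeasure_mono e hn (fun j => (hs _).1.symm) (fun j => (hs _).2)
      rfl le_rfl le_rfl
  simp only [conformalTransducer_eq_smoothedRank]
  refine smoothedRank_le_smoothedRank τ.2 (fun j => ?_) fun j => ?_
  · refine Fin.lastCases (fun hj => absurd hj (lt_irrefl _)) (fun i hi => ?_) j
    exact (hcast i).trans_lt (hi.trans_le hlast)
  · refine Fin.lastCases (fun _ => le_rfl) (fun i hi => ?_) j
    exact (hcast i).trans (hi.trans hlast)

/-- Below all training responses and below `0` (the threshold of the empty-cell default) the test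
score is `0`, the least possible, and `τ = 0` discards its ties. -/
theorem tendsto_atBot_conformalTransducer_histogram (e : X → ℝ) {n : ℕ} (hn : 0 < h n)
    (z : Fin n → ExtObs X) (x : X) (θ : unitInterval) :
    Tendsto (fun y : ℝ => conformalTransducer (histogramConformityMeasure e h) n z ((x, y), θ) 0)
      atBot (𝓝 0) := by
  refine tendsto_const_nhds.congr' ?_
  filter_upwards [eventually_lt_atBot 0, eventually_all.2 fun i => eventually_lt_atBot (z i).1.2]
    with y hy0 hy
  have h0 : histogramConformityMeasure e h n z ((x, y), θ) = 0 := by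
    rw [histogramConformityMeasure_eq e hn, if_neg (not_le.2 hy0)]
    have : cellRank e h z ((x, y), θ) = 0 := by
      refine Finset.card_eq_zero.2 (Finset.filter_eq_empty_iff.2 fun i _ hi => ?_)
      rcases (key_le_key _ _).1 hi.2 with h | h
      · exact lt_asymm h (hy i)
      · exact (hy i).ne h.1.symm
    simp [this]
  rw [conformalTransducer_eq_smoothedRank, smoothedRank_eq, conformityScore_last, h0]
  have : (Finset.univ.filter fun j =>
      conformityScore (histogramConformityMeasure e h) n z ((x, y), θ) j < 0) = ∅ :=
    Finset.filter_eq_empty_iff.2 fun j _ =>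
      not_lt.2 (histogramConformityMeasure_mem_Icc e hn _ _).1
  rw [this]
  simp

/-- Symmetrically, the test score eventually takes the greatest possible value `1`, and `τ = 1`
counts all its ties. -/
theorem tendsto_atTop_conformalTransducer_histogram (e : X → ℝ) {n : ℕ} (hn : 0 < h n)
    (z : Fin n → ExtObs X) (x : X) (θ : unitInterval) :
    Tendsto (fun y : ℝ => conformalTransducer (histogramConformityMeasure e h) n z ((x, y), θ) 1)
      atTop (𝓝 1) := by
  refine tendsto_const_nhds.congr' ?_
  filter_upwards [eventually_gt_atTop 0, eventually_all.2 fun i => eventually_gt_atTop (z i).1.2]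
    with y hy0 hy
  have h0 : histogramConformityMeasure e h n z ((x, y), θ) = 1 := by
    rw [histogramConformityMeasure_eq e hn, if_pos hy0.le]
    have : cellRank e h z ((x, y), θ) = cellCount e h z x := by
      refine congrArg _ (Finset.filter_congr fun i _ => ?_)
      exact and_iff_left ((key_le_key _ _).2 (Or.inl (hy i)))
    rw [this]
    split_ifs with h1
    · rfl
    · exact div_self (Nat.cast_ne_zero.2 h1)
  rw [conformalTransducer_eq_smoothedRank, smoothedRank_eq, conformityScore_last, h0]
  have : (Finset.univ.filter fun j =>
      conformityScore (histogramConformityMeasure e h) n z ((x, y), θ) j ≤ 1) = Finset.univ :=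
    Finset.filter_true_of_mem fun j _ => (histogramConformityMeasure_mem_Icc e hn _ _).2
  rw [this]
  simp
  field_simp

theorem isRandomizedPredictiveSystem_histogram [MeasurableSpace X] (he : Measurable e) (hh : IsBandwidth h) :
    IsRandomizedPredictiveSystem (conformalTransducer (histogramConformityMeasure e h)) where
  measurable _ hn :=
    (isRandomizedConformityMeasure_histogram he hh).measurable_conformalTransducer hn
  mem_Icc _ _ _ _ τ := smoothedRank_mem_Icc _ _ τ.2
  monotone_response n _ := monotone_conformalTransducer_histogram e (hh.pos n)
  monotone_tau _ _ _ _ := fun _ _ hτ => smoothedRank_mono _ _ hτ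
  tendsto_atBot n _ := tendsto_atBot_conformalTransducer_histogram e (hh.pos n)
  tendsto_atTop n _ := tendsto_atTop_conformalTransducer_histogram e (hh.pos n)
  uniform _ hn P _ _ hα :=
    (isRandomizedConformityMeasure_histogram he hh).law_conformalTransducer_le hn P hα

end

end ConformalPrediction

/-! ### Deterministic comparison of the transducer with the empirical distribution in a cell -/

namespace ConformalPrediction

section Rank
variable {ι κ : Type*} [LinearOrder κ]

/-- Distinct keys give distinct ranks, so the ranks in `C` run through the integers from `0` to `|C|
- 1`; the next two bounds count those below a threshold. -/
theorem rank_injOn (C : Finset ι) {k : ι → κ} (hk : Set.InjOn k C) :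
    Set.InjOn (fun i => (C.filter fun j => k j < k i).card) C := by
  have hlt : ∀ i ∈ C, ∀ i' : ι, k i < k i' →
      (C.filter fun j => k j < k i).card < (C.filter fun j => k j < k i').card := by
    intro i hi i' h
    refine Finset.card_lt_card ⟨fun j hj => ?_, fun hsub => ?_⟩
    · simp only [Finset.mem_filter] at hj ⊢
      exact ⟨hj.1, hj.2.trans h⟩
    · have := hsub (Finset.mem_filter.2 ⟨hi, h⟩)
      exact lt_irrefl _ (Finset.mem_filter.1 this).2
  intro i hi i' hi' h
  rcases lt_trichotomy (k i) (k i') with h1 | h1 | h1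
  · exact absurd h (hlt i hi i' h1).ne
  · exact hk hi hi' h1
  · exact absurd h (hlt i' hi' i h1).ne'

theorem card_rank_le (C : Finset ι) {k : ι → κ} (hk : Set.InjOn k C) {v : ℝ} (hv : 0 ≤ v) :
    ((C.filter fun i => ((C.filter fun j => k j < k i).card : ℝ) ≤ v).card : ℝ) ≤ v + 1 := by
  have h : (C.filter fun i => ((C.filter fun j => k j < k i).card : ℝ) ≤ v).card
      ≤ (Finset.range (⌊v⌋₊ + 1)).card := by
    refine Finset.card_le_card_of_injOn (fun i => (C.filter fun j => k j < k i).card) ?_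
      ((rank_injOn C hk).mono (by intro i hi; exact (Finset.mem_filter.1 hi).1))
    intro i hi
    simp only [Finset.coe_range, Set.mem_Iio, Nat.lt_succ_iff]
    exact Nat.le_floor (Finset.mem_filter.1 hi).2
  rw [Finset.card_range] at h
  calc _ ≤ ((⌊v⌋₊ + 1 : ℕ) : ℝ) := by exact_mod_cast h
    _ ≤ v + 1 := by push_cast; linarith [Nat.floor_le hv]

theorem le_card_rank_lt (C : Finset ι) {k : ι → κ} (hk : Set.InjOn k C) {v : ℝ}
    (hv : v ≤ C.card) :
    v ≤ (C.filter fun i => ((C.filter fun j => k j < k i).card : ℝ) < v).card := by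
  have h : (C.filter fun i => ¬ ((C.filter fun j => k j < k i).card : ℝ) < v).card
      ≤ (Finset.Ico ⌈v⌉₊ C.card).card := by
    refine Finset.card_le_card_of_injOn (fun i => (C.filter fun j => k j < k i).card) ?_
      ((rank_injOn C hk).mono (by intro i hi; exact (Finset.mem_filter.1 hi).1))
    intro i hi
    have hi' := Finset.mem_filter.1 hi
    simp only [Finset.coe_Ico, Set.mem_Ico]
    refine ⟨Nat.ceil_le.2 (not_lt.1 hi'.2), Finset.card_lt_card ?_⟩
    exact Finset.filter_ssubset.2 ⟨i, hi'.1, lt_irrefl _⟩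
  rw [Nat.card_Ico] at h
  have hc : ⌈v⌉₊ ≤ C.card := Nat.ceil_le.2 hv
  have h1 := Finset.card_filter_add_card_filter_not (s := C)
    fun i => ((C.filter fun j => k j < k i).card : ℝ) < v
  have h2 : ⌈v⌉₊ ≤ (C.filter fun i => ((C.filter fun j => k j < k i).card : ℝ) < v).card := by
    omega
  exact (Nat.le_ceil v).trans (by exact_mod_cast h2)

end Rank

theorem card_filter_succAbove {n : ℕ} (i : Fin (n + 1)) (p : Fin (n + 1) → Prop)
    [DecidablePred p] : (Finset.univ.filter fun k : Fin n => p (i.succAbove k)).card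
      = ((Finset.univ.filter p).erase i).card := by
  refine Finset.card_bij (fun k _ => i.succAbove k) (fun k hk => ?_)
    (fun k _ k' _ h => Fin.succAbove_right_injective h) fun j hj => ?_
  · simpa [Fin.succAbove_ne] using hk
  · simp only [Finset.mem_erase, Finset.mem_filter, Finset.mem_univ, true_and] at hj
    obtain ⟨k, rfl⟩ := Fin.exists_succAbove_eq hj.1
    exact ⟨k, by simpa using hj.2, rfl⟩

variable {X : Type*} {e : X → ℝ} {h : ℕ → ℝ} {n : ℕ}

/-- The indices of the elements of a sequence in the cell with index `k`. -/
noncomputable def cellMembers (e : X → ℝ) (h : ℕ → ℝ) (n : ℕ) {m : ℕ} (s : Fin m → ExtObs X)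
    (k : ℤ) : Finset (Fin m) := Finset.univ.filter fun i => cell e h n (s i).1.1 = k

/-- Leaving out `i` removes one member of the cell, and with distinct keys "at most" means "below"
for the others. The scores in the cell are thus equally spaced on `[0, 1]`. Singleton cells are
excluded because the score there is the default value. -/
theorem seqScore_histogram (hn : 0 < h n) {s : Fin (n + 1) → ExtObs X}
    (hs : Function.Injective fun i => key (s i)) {k : ℤ} {i : Fin (n + 1)}
    (hi : i ∈ cellMembers e h n s k) (h1 : (cellMembers e h n s k).card ≠ 1) :
    seqScore (histogramConformityMeasure e h) s i
      = (((cellMembers e h n s k).filter fun j => key (s j) < key (s i)).card : ℝ)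
        / ((cellMembers e h n s k).card - 1 : ℝ) := by
  have hik : cell e h n (s i).1.1 = k := (Finset.mem_filter.1 hi).2
  have hN : cellCount e h (fun j => s (i.succAbove j)) (s i).1.1
      = (cellMembers e h n s k).card - 1 := by
    unfold cellCount
    rw [card_filter_succAbove i fun j => cell e h n (s j).1.1 = cell e h n (s i).1.1, hik]
    exact Finset.card_erase_of_mem hi
  have ha : cellRank e h (fun j => s (i.succAbove j)) (s i)
      = ((cellMembers e h n s k).filter fun j => key (s j) < key (s i)).card := by
    unfold cellRank
    rw [card_filter_succAbove i fun j => cell e h n (s j).1.1 = cell e h n (s i).1.1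
      ∧ key (s j) ≤ key (s i), hik]
    congr 1
    ext j
    simp only [cellMembers, Finset.mem_erase, Finset.mem_filter, Finset.mem_univ, true_and]
    constructor
    · rintro ⟨hj, hc, hle⟩
      exact ⟨hc, hle.lt_of_ne fun h => hj (hs h)⟩
    · rintro ⟨hc, hlt⟩
      exact ⟨fun h => hlt.ne (by rw [h]), hc, hlt.le⟩
  have hpos : 0 < (cellMembers e h n s k).card := Finset.card_pos.2 ⟨i, hi⟩
  unfold seqScore
  rw [histogramConformityMeasure_eq e hn, hN, ha, if_neg (by omega), Nat.cast_sub hpos]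
  simp

/-- Equally spaced scores are as uniform as possible, so the counts below and up to `u` miss the
proportional value by at most one on the relevant side, independently of the responses. -/
theorem card_cellMembers_bounds (hn : 0 < h n) {s : Fin (n + 1) → ExtObs X}
    (hs : Function.Injective fun i => key (s i)) {k : ℤ}
    (hk : (cellMembers e h n s k).Nonempty) {u : ℝ} (hu : u ∈ Set.Icc (0 : ℝ) 1) :
    (cellMembers e h n s k).card * u - 1 ≤ ((cellMembers e h n s k).filter fun i =>
        seqScore (histogramConformityMeasure e h) s i < u).card ∧
    (((cellMembers e h n s k).filter fun i =>
        seqScore (histogramConformityMeasure e h) s i ≤ u).card : ℝ)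
      ≤ (cellMembers e h n s k).card * u + 1 := by
  set C := cellMembers e h n s k with hC
  have hpos : 0 < C.card := Finset.card_pos.2 hk
  obtain ⟨hu0, hu1⟩ := hu
  -- In a singleton cell the score is arbitrary in `{0, 1}`, but the bounds are trivial.
  rcases eq_or_ne C.card 1 with h1 | h1
  · have : (C.filter fun i => seqScore (histogramConformityMeasure e h) s i ≤ u).card ≤ 1 :=
      (Finset.card_filter_le _ _).trans_eq h1
    have h2 : ((C.filter fun i => seqScore (histogramConformityMeasure e h) s i ≤ u).card : ℝ) ≤ 1 := by
      exact_mod_cast this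
    rw [h1, Nat.cast_one, one_mul]
    exact ⟨by linarith [Nat.cast_nonneg (α := ℝ) (C.filter fun i =>
      seqScore (histogramConformityMeasure e h) s i < u).card], by linarith⟩
  have hK : (0 : ℝ) < C.card - 1 := by
    have : 1 < C.card := by omega
    rw [sub_pos]; exact_mod_cast this
  have e1 : (C.filter fun i => seqScore (histogramConformityMeasure e h) s i < u)
      = C.filter fun i => ((C.filter fun j => key (s j) < key (s i)).card : ℝ)
        < u * (C.card - 1) :=
    Finset.filter_congr fun i hi => by rw [seqScore_histogram hn hs hi h1, div_lt_iff₀ hK]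
  have e2 : (C.filter fun i => seqScore (histogramConformityMeasure e h) s i ≤ u)
      = C.filter fun i => ((C.filter fun j => key (s j) < key (s i)).card : ℝ)
        ≤ u * (C.card - 1) :=
    Finset.filter_congr fun i hi => by rw [seqScore_histogram hn hs hi h1, div_le_iff₀ hK]
  rw [e1, e2]
  have hinj : Set.InjOn (fun i => key (s i)) C := hs.injOn
  constructor
  · refine le_trans ?_ (le_card_rank_lt C hinj (by nlinarith))
    nlinarith
  · refine (card_rank_le C hinj (by positivity)).trans ?_
    nlinarith

/-- The number of occupied cells. -/
noncomputable def numCells (e : X → ℝ) (h : ℕ → ℝ) (n : ℕ) {m : ℕ} (s : Fin m → ExtObs X) : ℕ :=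
  (Finset.univ.image fun i => cell e h n (s i).1.1).card

/-- Each occupied cell contributes an error of at most one to the number of scores below (or up to)
`u`, whose main term is `(n + 1) u`. Taking `u` to be the score of `i` shows that ranking scores
across all cells essentially returns the score. -/
theorem abs_smoothedRank_sub_le (hn : 0 < h n) {s : Fin (n + 1) → ExtObs X}
    (hs : Function.Injective fun i => key (s i)) (i : Fin (n + 1)) {τ : ℝ}
    (hτ : τ ∈ Set.Icc (0 : ℝ) 1) :
    |smoothedRank (seqScore (histogramConformityMeasure e h) s) i τ
      - seqScore (histogramConformityMeasure e h) s i| ≤ numCells e h n s / (n + 1) := by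
  set a := seqScore (histogramConformityMeasure e h) s with ha
  set u := a i with hu
  have hu01 : u ∈ Set.Icc (0 : ℝ) 1 := histogramConformityMeasure_mem_Icc e hn _ _
  set K := Finset.univ.image fun i => cell e h n (s i).1.1 with hK
  have hsum : ∀ p : Fin (n + 1) → Prop, ∀ [DecidablePred p],
      ((Finset.univ.filter p).card : ℝ)
        = ∑ k ∈ K, (((cellMembers e h n s k).filter p).card : ℝ) := by
    intro p _
    rw [Finset.card_eq_sum_card_fiberwise (f := fun i => cell e h n (s i).1.1) (t := K)
      fun i _ => Finset.mem_coe.2 (Finset.mem_image_of_mem _ (Finset.mem_univ i)), Nat.cast_sum]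
    refine Finset.sum_congr rfl fun k _ => ?_
    rw [cellMembers, Finset.filter_filter, Finset.filter_filter]
    simp only [and_comm]
  have htot : (n + 1 : ℝ) = ∑ k ∈ K, ((cellMembers e h n s k).card : ℝ) := by
    have := hsum fun _ => True
    simpa using this
  have hne : ∀ k ∈ K, (cellMembers e h n s k).Nonempty := by
    intro k hk
    obtain ⟨i, _, hi⟩ := Finset.mem_image.1 hk
    exact ⟨i, by simp [cellMembers, hi]⟩
  have hlow : (n + 1) * u - K.card ≤ (Finset.univ.filter fun j => a j < u).card := by
    rw [hsum, htot, Finset.sum_mul, Finset.card_eq_sum_ones, Nat.cast_sum,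
      ← Finset.sum_sub_distrib]
    refine Finset.sum_le_sum fun k hk => ?_
    simpa using (card_cellMembers_bounds hn hs (hne k hk) hu01).1
  have hhigh : ((Finset.univ.filter fun j => a j ≤ u).card : ℝ) ≤ (n + 1) * u + K.card := by
    rw [hsum, htot, Finset.sum_mul, Finset.card_eq_sum_ones K, Nat.cast_sum,
      ← Finset.sum_add_distrib]
    refine Finset.sum_le_sum fun k hk => ?_
    simpa using (card_cellMembers_bounds hn hs (hne k hk) hu01).2
  have hle : ((Finset.univ.filter fun j => a j < u).card : ℝ)
      ≤ (Finset.univ.filter fun j => a j ≤ u).card :=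
    Nat.cast_le.2 (Finset.card_le_card (Finset.monotone_filter_right _ fun j _ h => h.le))
  have hn1 : (0 : ℝ) < n + 1 := by positivity
  have hτ1 := sub_nonneg.2 hτ.2
  rw [smoothedRank_eq, abs_le, neg_le_sub_iff_le_add, ← add_div, sub_le_iff_le_add',
    div_le_iff₀ hn1, le_div_iff₀ hn1, add_mul, div_mul_cancel₀ _ hn1.ne']
  change _ ≤ _ + (K.card : ℝ) ∧ _ ≤ _ + (K.card : ℝ)
  obtain ⟨hτ0, _⟩ := hτ
  constructor <;> nlinarith

/-- The number of observations in the cell with index `k` with response in `T`. -/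
noncomputable def cellCountIn (e : X → ℝ) (h : ℕ → ℝ) {n : ℕ} (z : Fin n → ExtObs X) (k : ℤ)
    (T : Set ℝ) : ℕ :=
  open scoped Classical in
  (Finset.univ.filter fun i => cell e h n (z i).1.1 = k ∧ (z i).1.2 ∈ T).card

/-- The indices of the cells meeting `[-R, R]`. -/
noncomputable def cellsWithin (h : ℕ → ℝ) (n : ℕ) (R : ℝ) : Finset ℤ :=
  Finset.Icc ⌊-R / h n⌋ ⌊R / h n⌋

theorem cell_mem_cellsWithin (hn : 0 < h n) {R : ℝ} {x : X} (hx : |e x| ≤ R) :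
    cell e h n x ∈ cellsWithin h n R := by
  rw [abs_le] at hx
  exact Finset.mem_Icc.2 ⟨Int.floor_mono (div_le_div_of_nonneg_right hx.1 hn.le),
    Int.floor_mono (div_le_div_of_nonneg_right hx.2 hn.le)⟩

theorem numCells_snoc_le (z : Fin n → ExtObs X) (w : ExtObs X) :
    numCells e h n (Fin.snoc z w : Fin (n + 1) → ExtObs X) ≤ numCells e h n z + 1 := by
  unfold numCells
  refine (Finset.card_le_card ?_).trans (Finset.card_insert_le (cell e h n w.1.1) _)
  intro k hk
  obtain ⟨i, _, rfl⟩ := Finset.mem_image.1 hk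
  refine Fin.lastCases ?_ (fun i => ?_) i
  · simp
  · simp

/-- Just to the right of `t` the test response ties with no training response, so its score is the
empirical distribution function of its cell at `t`, whatever `θ` is. Distinct training tie-breakers
make all keys distinct even when training responses coincide. -/
theorem abs_rightLim_conformalTransducer_sub_le (hn : 0 < h n)
    {z : Fin n → ExtObs X} (hz : Function.Injective fun i => (z i).2) (x : X) (θ τ : unitInterval)
    (t : ℝ) (hM : cellCountIn e h z (cell e h n x) Set.univ ≠ 0) :
    |Function.rightLim (fun y : ℝ =>
        conformalTransducer (histogramConformityMeasure e h) n z ((x, y), θ) τ) t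
      - (cellCountIn e h z (cell e h n x) (Set.Iic t) : ℝ)
        / cellCountIn e h z (cell e h n x) Set.univ| ≤ (numCells e h n z + 1) / (n + 1) := by
  have hmono := monotone_conformalTransducer_histogram e hn z x θ τ
  have hlim := (hmono.tendsto_rightLim t).sub_const
    ((cellCountIn e h z (cell e h n x) (Set.Iic t) : ℝ)
        / cellCountIn e h z (cell e h n x) Set.univ)
  refine le_of_tendsto hlim.abs ?_
  -- For `y` close to `t` from the right, no training response lies in `(t, y]`.
  have hgap : ∀ i, ∀ᶠ y in 𝓝[>] t, ((z i).1.2 ≤ t ∧ (z i).1.2 < y) ∨ (t < (z i).1.2 ∧ y < (z i).1.2) := by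
    intro i
    rcases le_or_gt (z i).1.2 t with hi | hi
    · filter_upwards [self_mem_nhdsWithin] with y hy
      exact Or.inl ⟨hi, hi.trans_lt hy⟩
    · filter_upwards [Ioo_mem_nhdsGT hi] with y hy
      exact Or.inr ⟨hi, hy.2⟩
  filter_upwards [eventually_all.2 hgap] with y hy
  have hcount : cellCount e h z x = cellCountIn e h z (cell e h n x) Set.univ := by
    unfold cellCount cellCountIn
    congr 1
    ext i; simp
  have hrank : cellRank e h z ((x, y), θ) = cellCountIn e h z (cell e h n x) (Set.Iic t) := by
    unfold cellRank cellCountIn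
    congr 1
    ext i
    simp only [Finset.mem_filter, key_le_key, Set.mem_Iic]
    have : ((z i).1.2 < y ∨ ((z i).1.2 = y ∧ (z i).2 ≤ θ)) ↔ (z i).1.2 ≤ t := by
      rcases hy i with ⟨h1, h2⟩ | ⟨h1, h2⟩
      · simp [h1, h2]
      · simp [h1.not_ge, h2.le, h2.ne']
    rw [this]
  have hscore : seqScore (histogramConformityMeasure e h)
      (Fin.snoc z ((x, y), θ) : Fin (n + 1) → ExtObs X) (Fin.last n)
      = (cellCountIn e h z (cell e h n x) (Set.Iic t) : ℝ)
        / cellCountIn e h z (cell e h n x) Set.univ := by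
    rw [← hrank, ← hcount]
    have := conformityScore_last (histogramConformityMeasure e h) n z ((x, y), θ)
    rw [histogramConformityMeasure_eq e hn, if_neg (by rwa [hcount])] at this
    exact this
  have hinj : Function.Injective fun i =>
      key ((Fin.snoc z ((x, y), θ) : Fin (n + 1) → ExtObs X) i) := by
    have hne : ∀ i, key (z i) ≠ key ((x, y), θ) := by
      intro i hi
      have h1 : (z i).1.2 = y := congrArg (fun p => (ofLex p).1) hi
      rcases hy i with h | h
      · exact h.2.ne h1
      · exact h.2.ne' h1
    intro i j
    refine Fin.lastCases ?_ (fun i => ?_) i <;> refine Fin.lastCases ?_ (fun j => ?_) j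
    · simp
    · intro hij
      simp only [Fin.snoc_last, Fin.snoc_castSucc] at hij
      exact absurd hij.symm (hne j)
    · intro hij
      simp only [Fin.snoc_last, Fin.snoc_castSucc] at hij
      exact absurd hij (hne i)
    · intro hij
      simp only [Fin.snoc_castSucc] at hij
      rw [hz (congrArg (fun p => (ofLex p).2) hij)]
  have key := abs_smoothedRank_sub_le (e := e) hn hinj (Fin.last n) τ.2
  rw [hscore] at key
  refine key.trans ?_
  gcongr
  exact_mod_cast numCells_snoc_le z _

end ConformalPrediction

/-! ### Convergence in probability, concentration of cell counts, number of occupied cells -/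

namespace ConformalPrediction

/-- Convergence to zero in probability under the joint laws of the observations. -/
def TendstoZeroInLaw {X : Type*} [MeasurableSpace X] (P : Measure (X × ℝ))
    (F : (n : ℕ) → (Fin n → ExtObs X) × ExtObs X × unitInterval → ℝ) : Prop :=
  ∀ ε : ℝ, 0 < ε → Tendsto (fun n => law P n {p | ε ≤ |F n p|}) atTop (𝓝 0)

variable {X : Type*} [MeasurableSpace X] {P : Measure (X × ℝ)} {e : X → ℝ} {h : ℕ → ℝ}

theorem tendsto_measure_zero_of_le_add {α : ℕ → Type*} [∀ n, MeasurableSpace (α n)]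
    {μ : ∀ n, Measure (α n)} {s t u : ∀ n, Set (α n)}
    (hs : ∀ᶠ n in atTop, ∀ᵐ p ∂μ n, p ∈ s n → p ∈ t n ∨ p ∈ u n)
    (ht : Tendsto (fun n => μ n (t n)) atTop (𝓝 0))
    (hu : Tendsto (fun n => μ n (u n)) atTop (𝓝 0)) :
    Tendsto (fun n => μ n (s n)) atTop (𝓝 0) := by
  refine tendsto_of_tendsto_of_tendsto_of_le_of_le' tendsto_const_nhds
    (by simpa using ht.add hu) (Eventually.of_forall fun _ => zero_le) ?_
  filter_upwards [hs] with n hn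
  exact (measure_mono_ae hn).trans (measure_union_le _ _)

theorem TendstoZeroInLaw.add
    {F G : (n : ℕ) → (Fin n → ExtObs X) × ExtObs X × unitInterval → ℝ}
    (hF : TendstoZeroInLaw P F) (hG : TendstoZeroInLaw P G) :
    TendstoZeroInLaw P fun n p => F n p + G n p := by
  intro ε hε
  refine tendsto_measure_zero_of_le_add (Eventually.of_forall fun n => ae_of_all _ fun p hp => ?_)
    (hF (ε / 2) (half_pos hε)) (hG (ε / 2) (half_pos hε))
  by_contra hcon
  simp only [Set.mem_ofPred_eq, not_or, not_le] at hcon hp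
  linarith [abs_add_le (F n p) (G n p)]

theorem TendstoZeroInLaw.abs
    {F : (n : ℕ) → (Fin n → ExtObs X) × ExtObs X × unitInterval → ℝ}
    (hF : TendstoZeroInLaw P F) : TendstoZeroInLaw P fun n p => |F n p| := by
  intro ε hε
  simpa using hF ε hε

theorem TendstoZeroInLaw.sum
    {F : ℕ → (n : ℕ) → (Fin n → ExtObs X) × ExtObs X × unitInterval → ℝ}
    (hF : ∀ j, TendstoZeroInLaw P (F j)) (m : ℕ) :
    TendstoZeroInLaw P fun n p => ∑ j ∈ Finset.range m, F j n p := by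
  induction m with
  | zero =>
    intro ε hε
    simp [hε.not_ge]
  | succ m ih =>
    simp only [Finset.sum_range_succ]
    exact ih.add (hF m)

section
variable [IsProbabilityMeasure P]

instance (n : ℕ) : IsProbabilityMeasure (law P n) := by
  unfold law; infer_instance

theorem measurePreserving_law_train (P : Measure (X × ℝ)) [IsProbabilityMeasure P] (n : ℕ) :
    MeasurePreserving Prod.fst (law P n)
      (Measure.pi fun _ : Fin n => P.prod (volume : Measure unitInterval)) :=
  measurePreserving_fst

theorem measurePreserving_law_test (P : Measure (X × ℝ)) [IsProbabilityMeasure P] (n : ℕ) :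
    MeasurePreserving (fun p : (Fin n → ExtObs X) × ExtObs X × unitInterval => p.2.1.1)
      (law P n) P :=
  measurePreserving_fst.comp (measurePreserving_fst.comp measurePreserving_snd)

/-- Only an inequality, so that it applies to sets not known to be measurable. -/
theorem law_test_le (n : ℕ) (s : Set (X × ℝ)) :
    law P n {p | p.2.1.1 ∈ s} ≤ P s := by
  have hm := measurePreserving_law_test P n
  calc law P n {p | p.2.1.1 ∈ s} ≤ Measure.map _ (law P n) s :=
        Measure.le_map_apply hm.measurable.aemeasurable s
    _ = P s := by rw [hm.map_eq]

theorem law_train_le (n : ℕ) (s : Set (Fin n → ExtObs X)) :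
    law P n {p | p.1 ∈ s} ≤ (Measure.pi fun _ : Fin n => P.prod (volume : Measure unitInterval)) s := by
  have hm := measurePreserving_law_train P n
  calc law P n {p | p.1 ∈ s} ≤ Measure.map _ (law P n) s :=
        Measure.le_map_apply hm.measurable.aemeasurable s
    _ = _ := by rw [hm.map_eq]

/-- Two independent values with a common atomless law agree with probability zero, by Fubini on the
diagonal; there are finitely many pairs. -/
theorem ae_injective_pi {E Θ : Type*} [MeasurableSpace E] [MeasurableSpace Θ]
    [MeasurableEq Θ] {μ : Measure E} [IsProbabilityMeasure μ] {g : E → Θ} (hg : Measurable g)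
    (hna : ∀ c, μ.map g {c} = 0) (n : ℕ) :
    ∀ᵐ z ∂(Measure.pi fun _ : Fin n => μ), Function.Injective fun i => g (z i) := by
  have hpair : ∀ i j : Fin n, i ≠ j → ∀ᵐ z ∂(Measure.pi fun _ : Fin n => μ), g (z i) ≠ g (z j) := by
    intro i j hij
    have hind := (ProbabilityTheory.iIndepFun_pi (μ := fun _ : Fin n => μ)
      (X := fun _ => g) fun _ => hg.aemeasurable).indepFun hij
    have hmeas : ∀ i, Measurable fun z : Fin n → E => g (z i) := fun i =>
      hg.comp (measurable_pi_apply i)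
    have hmap : ∀ i, Measure.map (fun z : Fin n → E => g (z i)) (Measure.pi fun _ => μ)
        = μ.map g := by
      intro i
      have := (measurePreserving_eval (fun _ : Fin n => μ) i).map_eq
      rw [show (fun z : Fin n → E => g (z i)) = g ∘ Function.eval i from rfl,
        ← Measure.map_map hg (measurable_pi_apply i), this]
    rw [ProbabilityTheory.indepFun_iff_map_prod_eq_prod_map_map (hmeas i).aemeasurable
      (hmeas j).aemeasurable, hmap, hmap] at hind
    have hprob : IsProbabilityMeasure (μ.map g) := Measure.isProbabilityMeasure_map hg.aemeasurable
    have hdiag : ((μ.map g).prod (μ.map g)) (Set.diagonal Θ) = 0 := by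
      rw [Measure.measure_prod_null measurableSet_diagonal]
      refine ae_of_all _ fun c => ?_
      have : Prod.mk c ⁻¹' Set.diagonal Θ = {c} := by
        ext x; simp [eq_comm]
      simpa [this] using hna c
    rw [← hind, Measure.map_apply ((hmeas i).prodMk (hmeas j)) measurableSet_diagonal] at hdiag
    rw [ae_iff]
    simpa [Set.diagonal] using hdiag
  have hall : ∀ᵐ z ∂(Measure.pi fun _ : Fin n => μ), ∀ i j : Fin n, i ≠ j → g (z i) ≠ g (z j) := by
    simp only [ae_all_iff]
    exact hpair
  filter_upwards [hall] with z hz i j hij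
  by_contra hne
  exact hz i j hne hij

theorem ae_injective_law (P : Measure (X × ℝ)) [IsProbabilityMeasure P] (n : ℕ) :
    ∀ᵐ p ∂law P n, Function.Injective fun i => (p.1 i).2 := by
  refine (measurePreserving_law_train P n).quasiMeasurePreserving.ae
    (ae_injective_pi measurable_snd (fun c => ?_) n)
  rw [measurePreserving_snd.map_eq]
  exact measure_singleton c

/-- Chebyshev's inequality for the number of elements of an i.i.d. sample in a set. -/
theorem measure_pi_count_le {E : Type*} [MeasurableSpace E] (μ : Measure E)
    [IsProbabilityMeasure μ] {B : Set E} [DecidablePred (· ∈ B)] (hB : MeasurableSet B) (n : ℕ)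
    {c : ℝ} (hc : 0 < c) :
    (Measure.pi fun _ : Fin n => μ)
      {z | c ≤ |((Finset.univ.filter fun i => z i ∈ B).card : ℝ) - n * μ.real B|}
      ≤ ENNReal.ofReal (n * μ.real B / c ^ 2) := by
  have hL : MemLp (B.indicator (1 : E → ℝ)) 2 μ :=
    memLp_indicator_const 2 hB 1 (Or.inr (measure_ne_top _ _))
  have hcomp : ∀ i : Fin n, MemLp (fun z : Fin n → E => B.indicator (1 : E → ℝ) (z i)) 2
      (Measure.pi fun _ : Fin n => μ) := fun i =>
    hL.comp_measurePreserving (measurePreserving_eval (fun _ : Fin n => μ) i)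
  set S : (Fin n → E) → ℝ := ∑ i, fun z => B.indicator (1 : E → ℝ) (z i) with hS
  have hSL : MemLp S 2 (Measure.pi fun _ : Fin n => μ) := memLp_finsetSum' _ fun i _ => hcomp i
  have hSz : ∀ z, S z = (Finset.univ.filter fun i => z i ∈ B).card := by
    intro z
    rw [hS, Finset.sum_apply, Finset.card_filter, Nat.cast_sum]
    refine Finset.sum_congr rfl fun i _ => ?_
    by_cases hi : z i ∈ B <;> simp [hi]
  have hmean : (∫ z, S z ∂(Measure.pi fun _ : Fin n => μ)) = n * μ.real B := by
    simp only [hS, Finset.sum_apply]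
    rw [integral_finsetSum _ fun i _ => (hcomp i).integrable one_le_two]
    simp only [integral_comp_eval (μ := fun _ : Fin n => μ) hL.1, integral_indicator_one hB]
    simp
  -- The variance of an indicator is at most its second moment, which equals its mean.
  have hvar : ProbabilityTheory.variance S (Measure.pi fun _ : Fin n => μ) ≤ n * μ.real B := by
    rw [hS, ProbabilityTheory.variance_sum_pi fun _ => hL]
    have : ProbabilityTheory.variance (B.indicator (1 : E → ℝ)) μ ≤ μ.real B := by
      refine (ProbabilityTheory.variance_le_expectation_sq hL.1).trans_eq ?_
      have : (B.indicator (1 : E → ℝ)) ^ 2 = B.indicator 1 := by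
        ext x; by_cases hx : x ∈ B <;> simp [hx]
      rw [this, integral_indicator_one hB]
    simpa using mul_le_mul_of_nonneg_left this (Nat.cast_nonneg n)
  have := ProbabilityTheory.meas_ge_le_variance_div_sq hSL hc
  rw [hmean] at this
  simp only [hSz] at this
  refine this.trans (ENNReal.ofReal_le_ofReal ?_)
  gcongr

/-- The probability that the predictor is in the cell with index `k` and the response in `T`. -/
noncomputable def cellProb (P : Measure (X × ℝ)) (e : X → ℝ) (h : ℕ → ℝ) (n : ℕ) (k : ℤ)
    (T : Set ℝ) : ℝ := P.real {v | cell e h n v.1 = k ∧ v.2 ∈ T}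

theorem measurableSet_cell (he : Measurable e) (n : ℕ) (k : ℤ) {T : Set ℝ} (hT : MeasurableSet T) :
    MeasurableSet {v : X × ℝ | cell e h n v.1 = k ∧ v.2 ∈ T} :=
  (((measurable_cell he h n).comp measurable_fst) (measurableSet_singleton k)).inter
    (measurable_snd hT)

theorem measure_pi_cellCountIn_le (he : Measurable e) {n : ℕ} (k : ℤ) {T : Set ℝ}
    (hT : MeasurableSet T) {c : ℝ} (hc : 0 < c) :
    (Measure.pi fun _ : Fin n => P.prod (volume : Measure unitInterval))
      {z | c ≤ |(cellCountIn e h z k T : ℝ) - n * cellProb P e h n k T|}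
      ≤ ENNReal.ofReal (n * cellProb P e h n k T / c ^ 2) := by
  classical
  have hB : MeasurableSet ((fun w : ExtObs X => w.1) ⁻¹' {v | cell e h n v.1 = k ∧ v.2 ∈ T}) :=
    measurable_fst (measurableSet_cell he n k hT)
  have hreal : (P.prod (volume : Measure unitInterval)).real
      ((fun w : ExtObs X => w.1) ⁻¹' {v | cell e h n v.1 = k ∧ v.2 ∈ T}) = cellProb P e h n k T :=
    measurePreserving_fst.measureReal_preimage (measurableSet_cell he n k hT).nullMeasurableSet
  have := measure_pi_count_le (P.prod (volume : Measure unitInterval)) hB n hc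
  rw [hreal] at this
  have hcount : ∀ z : Fin n → ExtObs X, cellCountIn e h z k T = (Finset.univ.filter fun i =>
      z i ∈ (fun w : ExtObs X => w.1) ⁻¹' {v | cell e h n v.1 = k ∧ v.2 ∈ T}).card := fun z => by
    unfold cellCountIn
    congr!
  simpa only [hcount] using this

/-- Given the test observation the cell is fixed and Chebyshev applies. Deviations are measured
against the expected count of the whole cell even when `T` is small, so no lower bound on the
probability of `T` is needed, and the estimate does not depend on `n`. -/
theorem law_cellCountIn_le (he : Measurable e) (n : ℕ) {T : Set ℝ} (hT : MeasurableSet T)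
    {L δ : ℝ} (hL : 0 < L) (hδ : 0 < δ) :
    law P n {p | L ≤ n * cellProb P e h n (cell e h n p.2.1.1.1) Set.univ ∧
      δ * (n * cellProb P e h n (cell e h n p.2.1.1.1) Set.univ)
        ≤ |(cellCountIn e h p.1 (cell e h n p.2.1.1.1) T : ℝ)
          - n * cellProb P e h n (cell e h n p.2.1.1.1) T|} ≤ ENNReal.ofReal (1 / (δ ^ 2 * L)) := by
  classical
  have hk : Measurable fun p : (Fin n → ExtObs X) × ExtObs X × unitInterval =>
      cell e h n p.2.1.1.1 := (measurable_cell he h n).comp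
    (measurable_fst.comp (measurable_fst.comp (measurable_fst.comp measurable_snd)))
  have hq : ∀ T, Measurable fun p : (Fin n → ExtObs X) × ExtObs X × unitInterval =>
      (n : ℝ) * cellProb P e h n (cell e h n p.2.1.1.1) T := fun T =>
    (measurable_from_top (f := fun k => (n : ℝ) * cellProb P e h n k T)).comp hk
  have hcnt : Measurable fun p : (Fin n → ExtObs X) × ExtObs X × unitInterval =>
      (cellCountIn e h p.1 (cell e h n p.2.1.1.1) T : ℝ) := by
    refine measurable_from_top.comp (measurable_card_filter _ fun i => ?_)
    have hi : Measurable fun p : (Fin n → ExtObs X) × ExtObs X × unitInterval => (p.1 i).1 :=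
      measurable_fst.comp ((measurable_pi_apply i).comp measurable_fst)
    exact (measurableSet_eq_fun ((measurable_cell he h n).comp (measurable_fst.comp hi)) hk).inter
      ((measurable_snd.comp hi) hT)
  have hmeas : MeasurableSet {p : (Fin n → ExtObs X) × ExtObs X × unitInterval |
      L ≤ n * cellProb P e h n (cell e h n p.2.1.1.1) Set.univ ∧
      δ * (n * cellProb P e h n (cell e h n p.2.1.1.1) Set.univ)
        ≤ |(cellCountIn e h p.1 (cell e h n p.2.1.1.1) T : ℝ)
          - n * cellProb P e h n (cell e h n p.2.1.1.1) T|} :=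
    (measurableSet_le measurable_const (hq _)).inter
      (measurableSet_le ((hq _).const_mul δ) (hcnt.sub (hq _)).abs)
  rw [law, Measure.prod_apply_symm hmeas]
  refine (lintegral_mono (g := fun _ => ENNReal.ofReal (1 / (δ ^ 2 * L))) fun w => ?_).trans
    (by simp)
  simp only [Set.preimage_ofPred_eq]
  set k := cell e h n w.1.1.1
  by_cases hLp : L ≤ n * cellProb P e h n k Set.univ
  · have hpos : 0 < n * cellProb P e h n k Set.univ := hL.trans_le hLp
    simp only [hLp, true_and]
    refine (measure_pi_cellCountIn_le he k hT (mul_pos hδ hpos)).trans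
      (ENNReal.ofReal_le_ofReal ?_)
    have hqp : cellProb P e h n k T ≤ cellProb P e h n k Set.univ :=
      measureReal_mono fun v hv => ⟨hv.1, trivial⟩
    calc n * cellProb P e h n k T / (δ * (n * cellProb P e h n k Set.univ)) ^ 2
        ≤ n * cellProb P e h n k Set.univ / (δ * (n * cellProb P e h n k Set.univ)) ^ 2 := by
          gcongr
      _ = 1 / (δ ^ 2 * (n * cellProb P e h n k Set.univ)) := by field_simp
      _ ≤ 1 / (δ ^ 2 * L) := by gcongr
  · simp [hLp]

/-- About `2 R / h_n` cells meet `[-R, R]`; this is where `n h_n → ∞` enters. -/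
theorem tendsto_card_cellsWithin_div (hh : IsBandwidth h) {R : ℝ} (hR : 0 ≤ R) :
    Tendsto (fun n : ℕ => ((cellsWithin h n R).card : ℝ) / n) atTop (𝓝 0) := by
  have hlim : Tendsto (fun n : ℕ => 2 * R / (n * h n) + 2 / (n : ℝ)) atTop (𝓝 0) := by
    simpa using (hh.tendsto_mul_atTop.const_div_atTop (2 * R)).add
      (tendsto_natCast_atTop_atTop.const_div_atTop (2 : ℝ))
  refine squeeze_zero (fun n => by positivity) (fun n => ?_) hlim
  have hn := hh.pos n
  have hcard : ((cellsWithin h n R).card : ℝ) ≤ 2 * R / h n + 2 := by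
    have hle : ⌊-R / h n⌋ ≤ ⌊R / h n⌋ + 1 := (Int.floor_mono
      (div_le_div_of_nonneg_right (by linarith) hn.le)).trans
        (le_add_of_nonneg_right zero_le_one)
    have : (((⌊R / h n⌋ + 1 - ⌊-R / h n⌋).toNat : ℤ) : ℝ) = ⌊R / h n⌋ + 1 - ⌊-R / h n⌋ := by
      rw [Int.toNat_of_nonneg (by linarith)]; push_cast; ring
    rw [cellsWithin, Int.card_Icc]
    calc (((⌊R / h n⌋ + 1 - ⌊-R / h n⌋).toNat : ℕ) : ℝ)
        = ⌊R / h n⌋ + 1 - ⌊-R / h n⌋ := by exact_mod_cast this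
      _ ≤ R / h n + 1 - (-R / h n - 1) := by
        linarith [Int.floor_le (R / h n), Int.lt_floor_add_one (-R / h n)]
      _ = 2 * R / h n + 2 := by ring
  calc ((cellsWithin h n R).card : ℝ) / n ≤ (2 * R / h n + 2) / n := by gcongr
    _ = 2 * R / (n * h n) + 2 / (n : ℝ) := by rw [add_div, div_div, mul_comm (h n)]

theorem exists_measure_abs_gt_lt (P : Measure (X × ℝ)) [IsProbabilityMeasure P]
    (he : Measurable e) {η : ℝ} (hη : 0 < η) :
    ∃ R : ℝ, 0 ≤ R ∧ P.real {v | R < |e v.1|} < η := by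
  have hlim : Tendsto (fun n : ℕ => P.real {v | (n : ℝ) < |e v.1|}) atTop (𝓝 0) := by
    have h1 := tendsto_measure_iInter_atTop (μ := P) (s := fun n : ℕ => {v | (n : ℝ) < |e v.1|})
      (fun n => (measurableSet_lt measurable_const
        (he.comp measurable_fst).abs).nullMeasurableSet)
      (fun m n hmn v (hv : (n : ℝ) < |e v.1|) =>
        show (m : ℝ) < |e v.1| from lt_of_le_of_lt (Nat.cast_le.2 hmn) hv) ⟨0, measure_ne_top _ _⟩
    have h2 : ⋂ n : ℕ, {v : X × ℝ | (n : ℝ) < |e v.1|} = ∅ := by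
      ext v
      obtain ⟨n, hn⟩ := exists_nat_ge |e v.1|
      simp only [Set.mem_iInter, Set.mem_ofPred_eq, Set.mem_empty_iff_false, iff_false, not_forall,
        not_lt]
      exact ⟨n, hn⟩
    rw [h2, measure_empty] at h1
    have h3 := (ENNReal.tendsto_toReal ENNReal.zero_ne_top).comp h1
    rw [ENNReal.toReal_zero] at h3
    exact h3
  obtain ⟨n, hn⟩ := (hlim.eventually (gt_mem_nhds hη)).exists
  exact ⟨n, Nat.cast_nonneg n, hn⟩

/-- The cell of a random predictor has probability of larger order than `1 / n`. -/
theorem tendsto_measure_cellProb_lt (he : Measurable e) (hh : IsBandwidth h) {L : ℝ} (hL : 0 < L) :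
    Tendsto (fun n : ℕ => P {v | n * cellProb P e h n (cell e h n v.1) Set.univ < L})
      atTop (𝓝 0) := by
  have hreal : Tendsto (fun n : ℕ =>
      P.real {v | n * cellProb P e h n (cell e h n v.1) Set.univ < L}) atTop (𝓝 0) := by
    rw [Metric.tendsto_atTop']
    intro η hη
    obtain ⟨R, hR0, hR⟩ := exists_measure_abs_gt_lt P he (half_pos hη)
    have h1 : Tendsto (fun n : ℕ => ((cellsWithin h n R).card : ℝ) / n * L) atTop (𝓝 0) := by
      simpa using (tendsto_card_cellsWithin_div hh hR0).mul_const L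
    obtain ⟨N, hN⟩ := eventually_atTop.1 ((h1.eventually (gt_mem_nhds (half_pos hη))).and
      (eventually_gt_atTop 0))
    refine ⟨N, fun n hn => ?_⟩
    obtain ⟨hlt, hn0⟩ := hN n hn.le
    rw [Real.dist_0_eq_abs, abs_of_nonneg measureReal_nonneg]
    have hn0' : (0 : ℝ) < n := Nat.cast_pos.2 hn0
    -- Either the predictor is far out, or it lies in one of the `o(n)` cells near the origin that
    -- have probability below `L / n`; together these cells have probability `o(1)`.
    have hsub : {v : X × ℝ | n * cellProb P e h n (cell e h n v.1) Set.univ < L}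
        ⊆ {v | R < |e v.1|} ∪ ⋃ k ∈ (cellsWithin h n R).filter fun k =>
          n * cellProb P e h n k Set.univ < L, {v | cell e h n v.1 = k ∧ v.2 ∈ Set.univ} := by
      intro v hv
      rcases lt_or_ge R |e v.1| with h | h
      · exact Or.inl h
      · refine Or.inr (Set.mem_biUnion (Finset.mem_coe.2 (Finset.mem_filter.2
          ⟨cell_mem_cellsWithin (hh.pos n) h, hv⟩)) ⟨rfl, trivial⟩)
    calc P.real {v | n * cellProb P e h n (cell e h n v.1) Set.univ < L}
        ≤ P.real {v | R < |e v.1|} + P.real (⋃ k ∈ (cellsWithin h n R).filter fun k =>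
          n * cellProb P e h n k Set.univ < L, {v | cell e h n v.1 = k ∧ v.2 ∈ Set.univ}) :=
          (measureReal_mono hsub).trans (measureReal_union_le _ _)
      _ ≤ P.real {v | R < |e v.1|} + ∑ k ∈ (cellsWithin h n R).filter fun k =>
          n * cellProb P e h n k Set.univ < L, cellProb P e h n k Set.univ := by
          gcongr
          exact measureReal_biUnion_finset_le _ _
      _ ≤ P.real {v | R < |e v.1|} + ∑ k ∈ (cellsWithin h n R).filter fun k =>
          n * cellProb P e h n k Set.univ < L, L / n := by
          gcongr with k hk
          rw [le_div_iff₀ hn0', mul_comm]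
          exact (Finset.mem_filter.1 hk).2.le
      _ ≤ P.real {v | R < |e v.1|} + (cellsWithin h n R).card * (L / n) := by
          rw [Finset.sum_const, nsmul_eq_mul]
          gcongr
          exact Finset.filter_subset _ _
      _ < η := by
          have : ((cellsWithin h n R).card : ℝ) * (L / n) = (cellsWithin h n R).card / n * L := by
            ring
          rw [this]; linarith
  have := ENNReal.tendsto_ofReal hreal
  simpa [Measure.real, ENNReal.ofReal_toReal (measure_ne_top P _)] using this

/-- The number of occupied cells is of smaller order than the sample size. -/
theorem tendstoZeroInLaw_numCells (he : Measurable e) (hh : IsBandwidth h) :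
    TendstoZeroInLaw P fun n p => (numCells e h n p.1 + 1) / (n + 1) := by
  classical
  intro ε hε
  obtain ⟨R, hR0, hR⟩ := exists_measure_abs_gt_lt P he (show 0 < ε / 4 by positivity)
  set B : Set (ExtObs X) := {w | R < |e w.1.1|} with hB
  have hBm : MeasurableSet B := measurableSet_lt measurable_const
    (he.comp (measurable_fst.comp measurable_fst)).abs
  have hBP : (P.prod (volume : Measure unitInterval)).real B < ε / 4 := by
    refine lt_of_eq_of_lt ?_ hR
    exact measurePreserving_fst.measureReal_preimage (s := {v : X × ℝ | R < |e v.1|})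
      (measurableSet_lt measurable_const (he.comp measurable_fst).abs).nullMeasurableSet
  have hbound : Tendsto (fun n : ℕ => ENNReal.ofReal (1 / ((ε / 4) ^ 2 * n))) atTop (𝓝 0) := by
    have : Tendsto (fun n : ℕ => 1 / ((ε / 4) ^ 2 * (n : ℝ))) atTop (𝓝 0) :=
      (tendsto_natCast_atTop_atTop.const_mul_atTop (by positivity)).const_div_atTop 1
    simpa using ENNReal.tendsto_ofReal this
  have h1 : Tendsto (fun n : ℕ => ((cellsWithin h n R).card : ℝ) / n + 1 / (n : ℝ)) atTop (𝓝 0) := by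
    simpa using (tendsto_card_cellsWithin_div hh hR0).add
      (tendsto_natCast_atTop_atTop.const_div_atTop (1 : ℝ))
  refine tendsto_of_tendsto_of_tendsto_of_le_of_le' tendsto_const_nhds hbound
    (Eventually.of_forall fun _ => zero_le) ?_
  filter_upwards [h1.eventually (gt_mem_nhds (show 0 < ε / 4 by positivity)),
    eventually_gt_atTop 0] with n hn hn0
  have hn0' : (0 : ℝ) < n := Nat.cast_pos.2 hn0
  rw [← add_div, div_lt_iff₀ hn0'] at hn
  -- Each far-out training point occupies at most one further cell. The nearby cells (with the extra
  -- one), the expected far-out points and the deviation of their number each use at most `ε / 4`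
  -- per observation.
  have hsub : {p : (Fin n → ExtObs X) × ExtObs X × unitInterval |
      ε ≤ |((numCells e h n p.1 : ℝ) + 1) / (n + 1)|} ⊆ {p | p.1 ∈ {z : Fin n → ExtObs X |
        ε / 4 * n ≤ |((Finset.univ.filter fun i => z i ∈ B).card : ℝ)
          - n * (P.prod (volume : Measure unitInterval)).real B|}} := by
    intro p hp
    simp only [Set.mem_ofPred_eq] at hp ⊢
    rw [abs_of_nonneg (by positivity), le_div_iff₀ (by positivity)] at hp
    have hcells : numCells e h n p.1 ≤ (cellsWithin h n R).card
        + (Finset.univ.filter fun i => p.1 i ∈ B).card := by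
      have : (Finset.univ.image fun i => cell e h n (p.1 i).1.1) ⊆ cellsWithin h n R ∪
          (Finset.univ.filter fun i => p.1 i ∈ B).image fun i => cell e h n (p.1 i).1.1 := by
        intro k hk
        obtain ⟨i, _, rfl⟩ := Finset.mem_image.1 hk
        rcases lt_or_ge R |e (p.1 i).1.1| with h | h
        · exact Finset.mem_union_right _ (Finset.mem_image_of_mem _ (by simp [hB, h]))
        · exact Finset.mem_union_left _ (cell_mem_cellsWithin (hh.pos n) h)
      exact (Finset.card_le_card this).trans ((Finset.card_union_le _ _).trans
        (Nat.add_le_add_left Finset.card_image_le _))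
    have hcells' : (numCells e h n p.1 : ℝ) ≤ (cellsWithin h n R).card
        + (Finset.univ.filter fun i => p.1 i ∈ B).card := by exact_mod_cast hcells
    have := le_abs_self (((Finset.univ.filter fun i => p.1 i ∈ B).card : ℝ)
          - n * (P.prod (volume : Measure unitInterval)).real B)
    nlinarith
  refine (measure_mono hsub).trans ((law_train_le n _).trans
    ((measure_pi_count_le _ hBm n (by positivity)).trans (ENNReal.ofReal_le_ofReal ?_)))
  calc n * (P.prod (volume : Measure unitInterval)).real B / (ε / 4 * n) ^ 2
      ≤ n * 1 / (ε / 4 * n) ^ 2 := by gcongr; exact measureReal_le_one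
    _ = 1 / ((ε / 4) ^ 2 * n) := by field_simp

end

end ConformalPrediction

/-! ### Nested cells, martingale convergence, and pointwise convergence of the predictive
distribution functions -/

namespace ConformalPrediction

theorem IsBandwidth.exists_eq_natPow_mul {h : ℕ → ℝ} (hh : IsBandwidth h) {m n : ℕ} (hmn : m ≤ n) :
    ∃ j : ℕ, h m = h n * ((2 ^ j : ℕ) : ℝ) := by
  obtain ⟨a, ha⟩ := hh.power_of_two m
  obtain ⟨b, hb⟩ := hh.power_of_two n
  have hle := hh.antitone hmn
  rw [ha, hb, zpow_le_zpow_iff_right₀ one_lt_two] at hle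
  refine ⟨(a - b).toNat, ?_⟩
  rw [ha, hb, Nat.cast_pow, ← zpow_natCast, Int.toNat_of_nonneg (sub_nonneg.2 hle), Nat.cast_ofNat,
    ← zpow_add₀ two_ne_zero]
  congr 1; ring

/-- Widths that are non-increasing powers of two have integer ratios, so finer cells refine coarser
ones; this makes the cell σ-algebras a filtration. -/
theorem IsBandwidth.cell_eq_div {X : Type*} {h : ℕ → ℝ} (hh : IsBandwidth h) (e : X → ℝ) {m n : ℕ}
    (hmn : m ≤ n) : ∃ j : ℕ, ∀ x, cell e h m x = cell e h n x / (j : ℤ) := by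
  obtain ⟨j, hj⟩ := hh.exists_eq_natPow_mul hmn
  refine ⟨2 ^ j, fun x => ?_⟩
  rw [cell, hj, ← div_div, Int.floor_div_natCast, cell]

variable {X : Type*} [MeasurableSpace X] {e : X → ℝ} {h : ℕ → ℝ}

/-- The filtration generated by the cells of the predictor. -/
noncomputable def cellFiltration (he : Measurable e) (hh : IsBandwidth h) :
    Filtration ℕ (inferInstance : MeasurableSpace (X × ℝ)) where
  seq n := MeasurableSpace.comap (fun v : X × ℝ => cell e h n v.1) ⊤
  mono' m n hmn := by
    obtain ⟨j, hj⟩ := hh.cell_eq_div e hmn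
    rintro s ⟨t, -, rfl⟩
    refine ⟨(fun k : ℤ => k / (j : ℤ)) ⁻¹' t, trivial, ?_⟩
    ext v
    simp only [Set.mem_preimage, hj]
  le' n := ((measurable_cell he h n).comp measurable_fst).comap_le

/-- The left endpoint of the cell of `x` is within `h_n` of `e x`, so `e x` is measurable in the
limit. A measurable embedding then recovers every measurable set of predictors from `e x`. -/
theorem iSup_cellFiltration (he : MeasurableEmbedding e) (hh : IsBandwidth h) :
    ⨆ n, cellFiltration he.measurable hh n
      = MeasurableSpace.comap (Prod.fst : X × ℝ → X) inferInstance := by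
  refine le_antisymm (iSup_le fun n => ?_) ?_
  · change MeasurableSpace.comap (cell e h n ∘ Prod.fst) ⊤ ≤ _
    rw [← MeasurableSpace.comap_comp]
    exact MeasurableSpace.comap_mono (measurable_cell he.measurable h n).comap_le
  · have hlim : Measurable[⨆ n, cellFiltration he.measurable hh n] fun v : X × ℝ => e v.1 := by
      refine @measurable_of_tendsto_metrizable (X × ℝ) ℝ (⨆ n, cellFiltration he.measurable hh n)
        _ _ _ _ (fun n v => cell e h n v.1 * h n) _ (fun n => ?_) ?_
      · have h1 : Measurable[cellFiltration he.measurable hh n] fun v : X × ℝ => cell e h n v.1 :=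
          comap_measurable _
        have h2 : Measurable[cellFiltration he.measurable hh n]
            fun v : X × ℝ => (cell e h n v.1 : ℝ) * h n :=
          (measurable_from_top (f := fun k : ℤ => (k : ℝ) * h n)).comp h1
        exact h2.mono (le_iSup (fun n => (cellFiltration he.measurable hh n :
          MeasurableSpace (X × ℝ))) n) le_rfl
      · rw [tendsto_pi_nhds]
        intro v
        have hsub : Tendsto (fun n => e v.1 - h n) atTop (𝓝 (e v.1)) := by
          simpa using hh.tendsto_zero.const_sub (e v.1)
        refine tendsto_of_tendsto_of_tendsto_of_le_of_le hsub tendsto_const_nhds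
          (fun n => ?_) fun n => ?_
        · have := Int.lt_floor_add_one (e v.1 / h n)
          rw [div_lt_iff₀ (hh.pos n)] at this
          simp only [cell]
          linarith
        · exact (le_div_iff₀ (hh.pos n)).1 (Int.floor_le (e v.1 / h n))
    rintro s ⟨t, ht, rfl⟩
    have : (Prod.fst : X × ℝ → X) ⁻¹' t = (fun v : X × ℝ => e v.1) ⁻¹' (e '' t) := by
      ext v; simp [he.injective.mem_set_image]
    rw [this]
    exact hlim (he.measurableSet_image.2 ht)

variable {P : Measure (X × ℝ)} [IsProbabilityMeasure P]

/-- The conditional expectation is constant on each cell; integrate it over the cell. The product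
form also covers cells of probability zero. -/
theorem cellProb_eq_mul_condExp (he : Measurable e) (hh : IsBandwidth h) (n : ℕ) {T : Set ℝ}
    (hT : MeasurableSet T) (v : X × ℝ) :
    cellProb P e h n (cell e h n v.1) T = cellProb P e h n (cell e h n v.1) Set.univ
      * (P[(Prod.snd ⁻¹' T).indicator fun _ => (1 : ℝ) | cellFiltration he hh n]) v := by
  set φ := P[(Prod.snd ⁻¹' T).indicator fun _ => (1 : ℝ) | cellFiltration he hh n] with hφ
  set s : Set (X × ℝ) := {u | cell e h n u.1 = cell e h n v.1 ∧ u.2 ∈ Set.univ} with hs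
  have hconst : ∀ u ∈ s, φ u = φ v := by
    have hm : StronglyMeasurable[cellFiltration he hh n] φ := stronglyMeasurable_condExp
    intro u hu
    exact StronglyMeasurable.factorsThrough (mY := ⊤) (f := fun v : X × ℝ => cell e h n v.1) hm hu.1
  have hsm : MeasurableSet[cellFiltration he hh n] s :=
    ⟨{cell e h n v.1}, trivial, by ext u; simp [hs]⟩
  have hTm : MeasurableSet ((Prod.snd : X × ℝ → ℝ) ⁻¹' T) := measurable_snd hT
  have h1 := setIntegral_condExp (μ := P) ((cellFiltration he hh).le n)
    ((integrable_const (1 : ℝ)).indicator hTm) hsm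
  rw [setIntegral_congr_fun ((cellFiltration he hh).le n _ hsm) hconst, setIntegral_const,
    setIntegral_indicator hTm, setIntegral_const, smul_eq_mul, smul_eq_mul, mul_one] at h1
  refine Eq.trans ?_ h1.symm
  rw [cellProb]
  congr 1
  ext u; simp [hs]

/-- The conditional distribution function of the response given the predictor. -/
noncomputable def cdfGiven (P : Measure (X × ℝ)) [IsProbabilityMeasure P] (t : ℝ) (v : X × ℝ) : ℝ :=
  (ProbabilityTheory.condDistrib Prod.snd Prod.fst P v.1).real (Set.Iic t)

/-- Lévy's upward theorem gives almost sure convergence under `P`, hence convergence in measure; the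
test observation has law `P`. -/
theorem tendstoZeroInLaw_condExp_sub_cdfGiven (he : MeasurableEmbedding e) (hh : IsBandwidth h)
    (t : ℝ) : TendstoZeroInLaw P fun n p =>
      (P[(Prod.snd ⁻¹' Set.Iic t).indicator fun _ => (1 : ℝ) |
        cellFiltration he.measurable hh n]) p.2.1.1 - cdfGiven P t p.2.1.1 := by
  have hae : ∀ᵐ v ∂P, Tendsto (fun n => (P[(Prod.snd ⁻¹' Set.Iic t).indicator fun _ => (1 : ℝ) |
        cellFiltration he.measurable hh n]) v) atTop (𝓝 (cdfGiven P t v)) := by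
    filter_upwards [tendsto_ae_condExp (μ := P) (ℱ := cellFiltration he.measurable hh)
      ((Prod.snd ⁻¹' Set.Iic t).indicator fun _ => (1 : ℝ)),
      ProbabilityTheory.condDistrib_ae_eq_condExp (μ := P) measurable_fst measurable_snd
        (measurableSet_Iic (a := t))] with v hv hv2
    rw [iSup_cellFiltration he hh] at hv
    rw [cdfGiven, hv2]
    exact hv
  have hmeas := tendstoInMeasure_of_tendsto_ae (fun n => (stronglyMeasurable_condExp.mono
    ((cellFiltration he.measurable hh).le n)).aestronglyMeasurable) hae
  rw [tendstoInMeasure_iff_dist] at hmeas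
  intro ε hε
  refine tendsto_of_tendsto_of_tendsto_of_le_of_le tendsto_const_nhds (hmeas ε hε)
    (fun _ => zero_le) fun n => ?_
  exact law_test_le n {v | ε ≤ dist ((P[(Prod.snd ⁻¹' Set.Iic t).indicator fun _ => (1 : ℝ) |
        cellFiltration he.measurable hh n]) v) (cdfGiven P t v)}

/-- Both errors are relative to `p`, so `q` may be arbitrarily small; the first term of the
decomposition is controlled by `S / M ≤ 1`. -/
theorem abs_div_sub_div_le {S M q p δ δ' : ℝ} (hS : 0 ≤ S) (hSM : S ≤ M) (hM : 0 < M) (hp : 0 < p)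
    (h1 : |M - p| ≤ δ * p) (h2 : |S - q| ≤ δ' * p) : |S / M - q / p| ≤ δ + δ' := by
  have e : S / M - q / p = (S / M) * ((p - M) / p) + (S - q) / p := by field_simp; ring
  rw [e]
  have hr : S / M ≤ 1 := div_le_one_of_le₀ hSM hM.le
  have hr0 : 0 ≤ S / M := by positivity
  have h3 : |(p - M) / p| ≤ δ := by
    rw [abs_div, abs_of_pos hp, div_le_iff₀ hp, abs_sub_comm]; exact h1
  have h4 : |(S - q) / p| ≤ δ' := by
    rw [abs_div, abs_of_pos hp, div_le_iff₀ hp]; exact h2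
  calc _ ≤ |S / M * ((p - M) / p)| + |(S - q) / p| := abs_add_le _ _
    _ ≤ 1 * |(p - M) / p| + |(S - q) / p| := by
      rw [abs_mul, abs_of_nonneg hr0]; gcongr
    _ ≤ δ + δ' := by linarith

/-- Three things can go wrong: too many occupied cells (`C`), a test cell of small expected count
(`Lo`), or a badly deviating count in that cell (`D`). Outside these events, for distinct
tie-breakers, the deterministic bounds apply. -/
theorem tendstoZeroInLaw_rightLim_sub_condExp (he : MeasurableEmbedding e) (hh : IsBandwidth h)
    (t : ℝ) : TendstoZeroInLaw P fun n p =>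
      Function.rightLim (fun y : ℝ => conformalTransducer (histogramConformityMeasure e h) n p.1
        ((p.2.1.1.1, y), p.2.1.2) p.2.2) t
      - (P[(Prod.snd ⁻¹' Set.Iic t).indicator fun _ => (1 : ℝ) |
        cellFiltration he.measurable hh n]) p.2.1.1 := by
  intro ε hε
  -- `δ < 1` forces the test cell to contain training points, and `2 δ` fits into `ε / 2`.
  set δ := min ε 1 / 8 with hδ
  have hδ0 : 0 < δ := by have := lt_min hε one_pos; positivity
  have hδε : 4 * δ ≤ ε / 2 := by have := min_le_left ε 1; linarith
  have hδ1 : δ < 1 := by have := min_le_right ε 1; linarith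
  let D : ℝ → Set ℝ → ∀ n, Set ((Fin n → ExtObs X) × ExtObs X × unitInterval) := fun L T n =>
    {p | L ≤ n * cellProb P e h n (cell e h n p.2.1.1.1) Set.univ ∧
      δ * (n * cellProb P e h n (cell e h n p.2.1.1.1) Set.univ)
        ≤ |(cellCountIn e h p.1 (cell e h n p.2.1.1.1) T : ℝ)
          - n * cellProb P e h n (cell e h n p.2.1.1.1) T|}
  let Lo : ℝ → ∀ n, Set ((Fin n → ExtObs X) × ExtObs X × unitInterval) := fun L n =>
    {p | p.2.1.1 ∈ {v : X × ℝ | n * cellProb P e h n (cell e h n v.1) Set.univ < L}}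
  let C : ∀ n, Set ((Fin n → ExtObs X) × ExtObs X × unitInterval) := fun n =>
    {p | ε / 2 ≤ |((numCells e h n p.1 : ℝ) + 1) / (n + 1)|}
  have hcover : ∀ L : ℝ, 0 < L → ∀ n : ℕ, ∀ᵐ p ∂law P n,
      p ∈ {p : (Fin n → ExtObs X) × ExtObs X × unitInterval | ε ≤ |Function.rightLim (fun y : ℝ =>
        conformalTransducer (histogramConformityMeasure e h) n p.1
          ((p.2.1.1.1, y), p.2.1.2) p.2.2) t
      - (P[(Prod.snd ⁻¹' Set.Iic t).indicator fun _ => (1 : ℝ) |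
        cellFiltration he.measurable hh n]) p.2.1.1|} →
      p ∈ (C n ∪ Lo L n) ∪ (D L Set.univ n ∪ D L (Set.Iic t) n) := by
    intro L hL n
    filter_upwards [ae_injective_law P n] with p hp hmem
    by_contra hcon
    simp only [Set.mem_union, not_or] at hcon
    obtain ⟨⟨hC, hLo⟩, hD1, hD2⟩ := hcon
    have hLp : L ≤ n * cellProb P e h n (cell e h n p.2.1.1.1) Set.univ := not_lt.1 hLo
    have hpos := hL.trans_le hLp
    replace hD1 := not_le.1 fun h => hD1 ⟨hLp, h⟩
    replace hD2 := not_le.1 fun h => hD2 ⟨hLp, h⟩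
    replace hC : |((numCells e h n p.1 : ℝ) + 1) / (n + 1)| < ε / 2 := not_le.1 hC
    have hM : (0 : ℝ) < cellCountIn e h p.1 (cell e h n p.2.1.1.1) Set.univ := by
      have := (abs_lt.1 hD1).1
      nlinarith
    have hSM : (cellCountIn e h p.1 (cell e h n p.2.1.1.1) (Set.Iic t) : ℝ)
        ≤ cellCountIn e h p.1 (cell e h n p.2.1.1.1) Set.univ := by
      refine Nat.cast_le.2 (Finset.card_le_card fun i hi => ?_)
      simp only [Finset.mem_filter] at hi ⊢
      exact ⟨hi.1, hi.2.1, trivial⟩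
    have hA := abs_rightLim_conformalTransducer_sub_le (hh.pos n) hp p.2.1.1.1 p.2.1.2 p.2.2 t
      (Nat.cast_ne_zero.1 hM.ne')
    have hB := abs_div_sub_div_le (Nat.cast_nonneg _) hSM hM hpos hD1.le hD2.le
    have hφ := cellProb_eq_mul_condExp (P := P) he.measurable hh n (measurableSet_Iic (a := t))
      p.2.1.1
    have hn0 : (n : ℝ) ≠ 0 := left_ne_zero_of_mul hpos.ne'
    have hc0 := right_ne_zero_of_mul hpos.ne'
    have hratio : n * cellProb P e h n (cell e h n p.2.1.1.1) (Set.Iic t)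
        / (n * cellProb P e h n (cell e h n p.2.1.1.1) Set.univ)
        = (P[(Prod.snd ⁻¹' Set.Iic t).indicator fun _ => (1 : ℝ) |
        cellFiltration he.measurable hh n]) p.2.1.1 := by
      rw [mul_div_mul_left _ _ hn0, hφ, mul_div_cancel_left₀ _ hc0]
    rw [hratio] at hB
    have hC' := lt_of_le_of_lt (le_abs_self _) hC
    have htri := abs_sub_le (Function.rightLim (fun y : ℝ =>
        conformalTransducer (histogramConformityMeasure e h) n p.1
          ((p.2.1.1.1, y), p.2.1.2) p.2.2) t)
      ((cellCountIn e h p.1 (cell e h n p.2.1.1.1) (Set.Iic t) : ℝ)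
        / cellCountIn e h p.1 (cell e h n p.2.1.1.1) Set.univ)
      ((P[(Prod.snd ⁻¹' Set.Iic t).indicator fun _ => (1 : ℝ) |
        cellFiltration he.measurable hh n]) p.2.1.1)
    have hmem' := hmem.trans htri
    linarith
  have hCLo : ∀ L : ℝ, 0 < L → Tendsto (fun n => law P n (C n) + law P n (Lo L n)) atTop (𝓝 0) := by
    intro L hL
    have h1 := tendstoZeroInLaw_numCells (P := P) he.measurable hh (ε / 2) (half_pos hε)
    have h2 : Tendsto (fun n => law P n (Lo L n)) atTop (𝓝 0) :=
      tendsto_of_tendsto_of_tendsto_of_le_of_le tendsto_const_nhds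
        (tendsto_measure_cellProb_lt (P := P) he.measurable hh hL) (fun _ => zero_le)
        fun n => law_test_le n _
    simpa using h1.add h2
  rw [ENNReal.tendsto_nhds_zero]
  intro η hη
  -- The bound on `D` is uniform in `n`, so `L` is fixed first to make it small; the other two
  -- events vanish as `n → ∞` for that `L`.
  have hLlim : Tendsto (fun L : ℝ => 2 * ENNReal.ofReal (1 / (δ ^ 2 * L))) atTop (𝓝 0) := by
    have : Tendsto (fun L : ℝ => 1 / (δ ^ 2 * L)) atTop (𝓝 0) :=
      (tendsto_id.const_mul_atTop (by positivity)).const_div_atTop 1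
    simpa using ENNReal.Tendsto.const_mul (a := 2) (ENNReal.tendsto_ofReal this) (Or.inr (by simp))
  have hη2 : 0 < η / 2 := ENNReal.half_pos hη.ne'
  obtain ⟨L, hL, hL0⟩ := ((ENNReal.tendsto_nhds_zero.1 hLlim (η / 2) hη2).and
    (eventually_gt_atTop 0)).exists
  filter_upwards [ENNReal.tendsto_nhds_zero.1 (hCLo L hL0) (η / 2) hη2] with n hn
  calc _ ≤ law P n ((C n ∪ Lo L n) ∪ (D L Set.univ n ∪ D L (Set.Iic t) n)) :=
        measure_mono_ae (hcover L hL0 n)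
    _ ≤ (law P n (C n) + law P n (Lo L n))
        + (law P n (D L Set.univ n) + law P n (D L (Set.Iic t) n)) :=
        (measure_union_le _ _).trans (add_le_add (measure_union_le _ _) (measure_union_le _ _))
    _ ≤ η / 2 + (ENNReal.ofReal (1 / (δ ^ 2 * L)) + ENNReal.ofReal (1 / (δ ^ 2 * L))) :=
        add_le_add hn (add_le_add
          (law_cellCountIn_le he.measurable n MeasurableSet.univ hL0 hδ0)
          (law_cellCountIn_le he.measurable n measurableSet_Iic hL0 hδ0))
    _ ≤ η / 2 + η / 2 := by rw [← two_mul]; gcongr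
    _ = η := ENNReal.add_halves η

/-- The predictive distribution functions converge in probability to the conditional distribution
function, at each point. -/
theorem tendstoZeroInLaw_rightLim_sub_cdfGiven (he : MeasurableEmbedding e) (hh : IsBandwidth h)
    (t : ℝ) : TendstoZeroInLaw P fun n p =>
      Function.rightLim (fun y : ℝ => conformalTransducer (histogramConformityMeasure e h) n p.1
        ((p.2.1.1.1, y), p.2.1.2) p.2.2) t - cdfGiven P t p.2.1.1 := by
  simpa using (tendstoZeroInLaw_rightLim_sub_condExp (P := P) he hh t).add
    (tendstoZeroInLaw_condExp_sub_cdfGiven he hh t)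

end ConformalPrediction

/-! ### From distribution functions to integrals, and universal consistency -/

namespace ConformalPrediction

/-- A Riemann–Stieltjes estimate: oscillation at most `δ` on a mass of at most one, plus `C` times a
bound on the mass outside the grid. Only increments of `F` matter, so `F` need not be normalized. -/
theorem abs_integral_sub_sum_le {ν : Measure ℝ} [IsFiniteMeasure ν] (hν : ν.real Set.univ ≤ 1)
    {F : ℝ → ℝ} (hF : ∀ a b, a ≤ b → ν.real (Set.Ioc a b) = F b - F a) {f : ℝ → ℝ}
    (hf : Continuous f) {C δ : ℝ} (hC : ∀ y, |f y| ≤ C) (hδ : 0 ≤ δ) {t : ℕ → ℝ} (ht : Monotone t)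
    {m : ℕ} (hosc : ∀ j < m, ∀ y ∈ Set.Ioc (t j) (t (j + 1)), |f y - f (t (j + 1))| ≤ δ) :
    |∫ y, f y ∂ν - ∑ j ∈ Finset.range m, f (t (j + 1)) * (F (t (j + 1)) - F (t j))|
      ≤ δ + C * (1 - (F (t m) - F (t 0))) := by
  have hint : Integrable f ν := Integrable.of_bound hf.aestronglyMeasurable C (ae_of_all _ hC)
  have hC0 : 0 ≤ C := (abs_nonneg _).trans (hC 0)
  have hsplit : ∑ j ∈ Finset.range m, ∫ y in Set.Ioc (t j) (t (j + 1)), f y ∂ν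
      = ∫ y in Set.Ioc (t 0) (t m), f y ∂ν := by
    have := intervalIntegral.sum_integral_adjacent_intervals (μ := ν) (f := f) (a := t) (n := m)
      fun k _ => hint.intervalIntegrable
    simpa only [intervalIntegral.integral_of_le (ht (Nat.le_succ _)),
      intervalIntegral.integral_of_le (ht (Nat.zero_le m))] using this
  have hcompl : |∫ y in (Set.Ioc (t 0) (t m))ᶜ, f y ∂ν| ≤ C * (1 - (F (t m) - F (t 0))) := by
    refine (norm_setIntegral_le_of_norm_le_const (f := f) (C := C) (measure_lt_top _ _)
      fun y _ => hC y).trans ?_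
    rw [measureReal_compl measurableSet_Ioc, hF _ _ (ht (Nat.zero_le m))]
    gcongr
  have hpiece : ∀ j ∈ Finset.range m, |∫ y in Set.Ioc (t j) (t (j + 1)), f y ∂ν
      - f (t (j + 1)) * (F (t (j + 1)) - F (t j))| ≤ δ * (F (t (j + 1)) - F (t j)) := by
    intro j hj
    rw [← hF _ _ (ht (Nat.le_succ j))]
    have : ∫ y in Set.Ioc (t j) (t (j + 1)), f y ∂ν
        - f (t (j + 1)) * ν.real (Set.Ioc (t j) (t (j + 1)))
        = ∫ y in Set.Ioc (t j) (t (j + 1)), (f y - f (t (j + 1))) ∂ν := by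
      rw [integral_sub hint.integrableOn (integrable_const _), setIntegral_const, smul_eq_mul,
        mul_comm]
    rw [this]
    exact norm_setIntegral_le_of_norm_le_const (f := fun y => f y - f (t (j + 1)))
      (measure_lt_top _ _)
      (hosc j (Finset.mem_range.1 hj))
  have hmass : F (t m) - F (t 0) ≤ 1 := by
    rw [← hF _ _ (ht (Nat.zero_le m))]
    exact (measureReal_mono (Set.subset_univ _)).trans hν
  rw [← integral_add_compl measurableSet_Ioc hint, ← hsplit, add_sub_right_comm,
    ← Finset.sum_sub_distrib]
  calc _ ≤ |∑ j ∈ Finset.range m, (∫ y in Set.Ioc (t j) (t (j + 1)), f y ∂ν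
        - f (t (j + 1)) * (F (t (j + 1)) - F (t j)))|
        + |∫ y in (Set.Ioc (t 0) (t m))ᶜ, f y ∂ν| := abs_add_le _ _
    _ ≤ ∑ j ∈ Finset.range m, δ * (F (t (j + 1)) - F (t j))
        + C * (1 - (F (t m) - F (t 0))) :=
        add_le_add ((Finset.abs_sum_le_sum_abs _ _).trans (Finset.sum_le_sum hpiece)) hcompl
    _ ≤ δ + C * (1 - (F (t m) - F (t 0))) := by
        rw [← Finset.mul_sum, Finset.sum_range_sub fun j => F (t j)]
        gcongr
        exact mul_le_of_le_one_right hδ hmass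

/-- A quantitative Helly–Bray theorem. Only the tail of the limit `ν'` appears: that of `ν` is
recovered from the deviations at the two ends of the grid, which accounts for half of the factor `4
C`. -/
theorem abs_integral_sub_integral_le {ν ν' : Measure ℝ} [IsFiniteMeasure ν] [IsFiniteMeasure ν']
    (hν : ν.real Set.univ ≤ 1) (hν' : ν'.real Set.univ ≤ 1) {F F' : ℝ → ℝ}
    (hF : ∀ a b, a ≤ b → ν.real (Set.Ioc a b) = F b - F a)
    (hF' : ∀ a b, a ≤ b → ν'.real (Set.Ioc a b) = F' b - F' a) {f : ℝ → ℝ}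
    (hf : Continuous f) {C δ : ℝ} (hC : ∀ y, |f y| ≤ C) (hδ : 0 ≤ δ) {t : ℕ → ℝ} (ht : Monotone t)
    {m : ℕ} (hosc : ∀ j < m, ∀ y ∈ Set.Ioc (t j) (t (j + 1)), |f y - f (t (j + 1))| ≤ δ) :
    |∫ y, f y ∂ν - ∫ y, f y ∂ν'| ≤ 2 * δ + 2 * C * (1 - (F' (t m) - F' (t 0)))
      + 4 * C * ∑ j ∈ Finset.range (m + 1), |F (t j) - F' (t j)| := by
  have hC0 : 0 ≤ C := (abs_nonneg _).trans (hC 0)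
  have h1 := abs_integral_sub_sum_le hν hF hf hC hδ ht hosc
  have h2 := abs_integral_sub_sum_le hν' hF' hf hC hδ ht hosc
  set d : ℕ → ℝ := fun j => |F (t j) - F' (t j)| with hd
  have hd0 : ∀ j, 0 ≤ d j := fun j => abs_nonneg _
  have h3 : |∑ j ∈ Finset.range m, f (t (j + 1)) * (F (t (j + 1)) - F (t j))
      - ∑ j ∈ Finset.range m, f (t (j + 1)) * (F' (t (j + 1)) - F' (t j))|
      ≤ 2 * C * ∑ j ∈ Finset.range (m + 1), d j := by
    rw [← Finset.sum_sub_distrib]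
    calc _ ≤ ∑ j ∈ Finset.range m, C * (d (j + 1) + d j) := by
          refine (Finset.abs_sum_le_sum_abs _ _).trans (Finset.sum_le_sum fun j _ => ?_)
          have e : f (t (j + 1)) * (F (t (j + 1)) - F (t j))
              - f (t (j + 1)) * (F' (t (j + 1)) - F' (t j))
              = f (t (j + 1)) * ((F (t (j + 1)) - F' (t (j + 1))) - (F (t j) - F' (t j))) := by
            ring
          rw [e, abs_mul]
          exact mul_le_mul (hC _) (abs_sub _ _) (abs_nonneg _) hC0
      _ = C * (∑ j ∈ Finset.range m, d (j + 1) + ∑ j ∈ Finset.range m, d j) := by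
          rw [← Finset.mul_sum, Finset.sum_add_distrib]
      _ ≤ C * (∑ j ∈ Finset.range (m + 1), d j + ∑ j ∈ Finset.range (m + 1), d j) := by
          gcongr
          · rw [Finset.sum_range_succ']
            linarith [hd0 0]
          · exact Nat.le_succ m
      _ = _ := by ring
  have h4 : d m ≤ ∑ j ∈ Finset.range (m + 1), d j :=
    Finset.single_le_sum (f := d) (fun j _ => hd0 j) (by simp)
  have h5 : d 0 ≤ ∑ j ∈ Finset.range (m + 1), d j :=
    Finset.single_le_sum (f := d) (fun j _ => hd0 j) (by simp)
  have h6 : 1 - (F (t m) - F (t 0)) ≤ 1 - (F' (t m) - F' (t 0)) + (d m + d 0) := by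
    have := neg_abs_le (F (t m) - F' (t m))
    have := le_abs_self (F (t 0) - F' (t 0))
    simp only [hd]
    linarith
  have h7 := mul_le_mul_of_nonneg_left h6 hC0
  have h8 := mul_le_mul_of_nonneg_left (add_le_add h4 h5) hC0
  rw [abs_le] at h1 h2 h3 ⊢
  constructor <;> linarith

theorem predictiveMeasure_real_Ioc {G : ℝ → ℝ} (hG : Monotone G) {a b : ℝ} (hab : a ≤ b) :
    (predictiveMeasure G).real (Set.Ioc a b) = Function.rightLim G b - Function.rightLim G a := by
  rw [predictiveMeasure, dif_pos hG, Measure.real, StieltjesFunction.measure_Ioc,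
    hG.stieltjesFunction_eq, hG.stieltjesFunction_eq,
    ENNReal.toReal_ofReal (sub_nonneg.2 (hG.rightLim hab))]

/-- Only a bound: for a fixed `τ` the limits of a predictive distribution function may lie strictly
between `0` and `1`, so some mass may be missing. -/
theorem predictiveMeasure_univ_le {G : ℝ → ℝ} (hG : Monotone G)
    (h01 : ∀ y, G y ∈ Set.Icc (0 : ℝ) 1) : predictiveMeasure G Set.univ ≤ 1 := by
  rw [predictiveMeasure, dif_pos hG]
  set S := hG.stieltjesFunction with hS
  have hS01 : ∀ y, S y ∈ Set.Icc (0 : ℝ) 1 := fun y => by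
    rw [hS, hG.stieltjesFunction_eq]
    exact isClosed_Icc.mem_of_tendsto (hG.tendsto_rightLim y) (Eventually.of_forall h01)
  have hbot := tendsto_atBot_ciInf S.mono ⟨0, by rintro _ ⟨y, rfl⟩; exact (hS01 y).1⟩
  have htop := tendsto_atTop_ciSup S.mono ⟨1, by rintro _ ⟨y, rfl⟩; exact (hS01 y).2⟩
  rw [S.measure_univ hbot htop]
  refine ENNReal.ofReal_le_one.2 ?_
  have h1 : ⨆ y, S y ≤ 1 := ciSup_le fun y => (hS01 y).2
  have h2 : 0 ≤ ⨅ y, S y := le_ciInf fun y => (hS01 y).1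
  linarith

/-- A bounded continuous function is nearly constant on the cells of a fine grid. -/
theorem exists_grid {f : ℝ → ℝ} (hf : Continuous f) {K : ℝ} (hK : 0 ≤ K) {δ : ℝ} (hδ : 0 < δ) :
    ∃ (m : ℕ) (t : ℕ → ℝ), Monotone t ∧ t 0 = -K ∧ t m = K ∧
      ∀ j < m, ∀ y ∈ Set.Ioc (t j) (t (j + 1)), |f y - f (t (j + 1))| ≤ δ := by
  obtain ⟨d, hd, huc⟩ := Metric.uniformContinuousOn_iff.1
    ((isCompact_Icc (a := -K) (b := K)).uniformContinuousOn_of_continuous hf.continuousOn) δ hδ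
  obtain ⟨m, hm⟩ := exists_nat_gt (2 * K / d)
  have hm0 : (0 : ℝ) < m := lt_of_le_of_lt (by positivity) hm
  have hstep : 2 * K / m < d := by
    rw [div_lt_iff₀ hd] at hm
    rw [div_lt_iff₀ hm0]; linarith
  have hstep0 : 0 ≤ 2 * K / m := by positivity
  have hmono : Monotone fun j : ℕ => -K + j * (2 * K / m) := by
    intro i j hij
    have : (i : ℝ) ≤ j := Nat.cast_le.2 hij
    simp only
    gcongr
  have hend : -K + m * (2 * K / m) = K := by field_simp; ring
  refine ⟨m, fun j => -K + j * (2 * K / m), hmono, by simp, hend, fun j hj y hy => ?_⟩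
  have h0 : -K ≤ -K + (j : ℝ) * (2 * K / m) := by
    have : 0 ≤ (j : ℝ) * (2 * K / m) := by positivity
    linarith
  have h1 : -K + ((j + 1 : ℕ) : ℝ) * (2 * K / m) ≤ K := by
    have := hmono (show j + 1 ≤ m from hj)
    simpa only [hend] using this
  have h2 : -K + ((j + 1 : ℕ) : ℝ) * (2 * K / m) = -K + (j : ℝ) * (2 * K / m) + 2 * K / m := by
    push_cast; ring
  obtain ⟨hy1, hy2⟩ := hy
  refine (huc y ⟨h0.trans hy1.le, hy2.trans h1⟩ _ ⟨by linarith, h1⟩ ?_).le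
  rw [Real.dist_eq, abs_lt]
  simp only at hy1 hy2
  constructor <;> linarith

variable {X : Type*} [MeasurableSpace X] {e : X → ℝ} {h : ℕ → ℝ}

theorem measurable_cdfGiven (P : Measure (X × ℝ)) [IsProbabilityMeasure P] (t : ℝ) :
    Measurable (cdfGiven P t) :=
  (((ProbabilityTheory.condDistrib Prod.snd Prod.fst P).measurable_coe measurableSet_Iic).comp
    measurable_fst).ennreal_toReal

/-- Each conditional law is a probability measure, so its tails vanish pointwise in `v`, hence in
probability. This gives one truncation level valid outside a small event. -/
theorem tendsto_measure_cdfGiven_tail (P : Measure (X × ℝ)) [IsProbabilityMeasure P] {ε : ℝ}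
    (hε : 0 < ε) : Tendsto (fun K : ℕ => P {v | ε ≤ 1 - (cdfGiven P K v - cdfGiven P (-K) v)})
      atTop (𝓝 0) := by
  have hae : ∀ v, Tendsto (fun K : ℕ => cdfGiven P K v - cdfGiven P (-K) v) atTop (𝓝 1) := by
    intro v
    have h1 := (ProbabilityTheory.tendsto_cdf_atTop
      (ProbabilityTheory.condDistrib Prod.snd Prod.fst P v.1)).comp
      (tendsto_natCast_atTop_atTop (R := ℝ))
    have h2 := (ProbabilityTheory.tendsto_cdf_atBot
      (ProbabilityTheory.condDistrib Prod.snd Prod.fst P v.1)).comp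
      (tendsto_neg_atTop_atBot.comp (tendsto_natCast_atTop_atTop (R := ℝ)))
    simpa [Function.comp_def, ProbabilityTheory.cdf_eq_real, cdfGiven] using h1.sub h2
  have hmeas := tendstoInMeasure_of_tendsto_ae (μ := P)
    (fun K : ℕ => ((measurable_cdfGiven P K).sub (measurable_cdfGiven P (-K))).aestronglyMeasurable)
    (ae_of_all _ hae)
  rw [tendstoInMeasure_iff_dist] at hmeas
  refine tendsto_of_tendsto_of_tendsto_of_le_of_le tendsto_const_nhds (hmeas ε hε)
    (fun _ => zero_le) fun K => measure_mono fun v hv => ?_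
  simp only [Set.mem_ofPred_eq] at hv ⊢
  rw [dist_comm]
  exact hv.trans (le_abs_self _)

theorem condExpGivenPredictor_ae_eq (P : Measure (X × ℝ)) [IsProbabilityMeasure P] {f : ℝ → ℝ}
    (hf : Continuous f) {C : ℝ} (hC : ∀ y, |f y| ≤ C) :
    condExpGivenPredictor P f =ᵐ[P] fun v =>
      ∫ y, f y ∂(ProbabilityTheory.condDistrib Prod.snd Prod.fst P v.1) :=
  ProbabilityTheory.condExp_ae_eq_integral_condDistrib measurable_fst measurable_snd.aemeasurable
    hf.stronglyMeasurable (Integrable.of_bound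
      (hf.measurable.comp measurable_snd).aestronglyMeasurable C (ae_of_all _ fun v => hC v.2))

theorem abs_integral_predictiveMeasure_sub_le {P : Measure (X × ℝ)} [IsProbabilityMeasure P]
    {G : ℝ → ℝ} (hG : Monotone G) (h01 : ∀ y, G y ∈ Set.Icc (0 : ℝ) 1) (v : X × ℝ) {f : ℝ → ℝ}
    (hf : Continuous f) {C δ : ℝ} (hC : ∀ y, |f y| ≤ C) (hδ : 0 ≤ δ) {t : ℕ → ℝ} (ht : Monotone t)
    {m : ℕ} (hosc : ∀ j < m, ∀ y ∈ Set.Ioc (t j) (t (j + 1)), |f y - f (t (j + 1))| ≤ δ) :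
    |∫ y, f y ∂predictiveMeasure G
      - ∫ y, f y ∂(ProbabilityTheory.condDistrib Prod.snd Prod.fst P v.1)|
      ≤ 2 * δ + 2 * C * (1 - (cdfGiven P (t m) v - cdfGiven P (t 0) v))
      + 4 * C * ∑ j ∈ Finset.range (m + 1), |Function.rightLim G (t j) - cdfGiven P (t j) v| := by
  have huniv := predictiveMeasure_univ_le hG h01
  have hfin : IsFiniteMeasure (predictiveMeasure G) := ⟨huniv.trans_lt ENNReal.one_lt_top⟩
  refine abs_integral_sub_integral_le (F' := fun s => cdfGiven P s v)
    (ENNReal.toReal_le_of_le_ofReal zero_le_one (by simpa using huniv)) (by simp)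
    (fun a b hab => predictiveMeasure_real_Ioc hG hab) (fun a b hab => ?_) hf hC hδ ht hosc
  rw [← Set.Iic_sdiff_Iic, measureReal_sdiff (Set.Iic_subset_Iic.2 hab) measurableSet_Iic]
  rfl

/-- The order of choices is the point: the truncation `K`, then a grid on `[-K, K]` adapted to `f`,
then `n` large for the finitely many grid points. The thresholds make each of the three terms of the
integral bound at most `ε / 3`. -/
theorem isUniversallyConsistent_histogram (he : MeasurableEmbedding e) (hh : IsBandwidth h) :
    IsUniversallyConsistent (conformalTransducer (histogramConformityMeasure e h)) := by
  intro P hP f hf ⟨C₀, hC₀⟩ ε hε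
  obtain ⟨C, hC, hC1⟩ : ∃ C, (∀ y, |f y| ≤ C) ∧ 0 < C :=
    ⟨max C₀ 1, fun y => (hC₀ y).trans (le_max_left _ _), lt_max_of_lt_right one_pos⟩
  rw [ENNReal.tendsto_nhds_zero]
  intro η hη
  have hη2 : 0 < η / 2 := ENNReal.half_pos hη.ne'
  obtain ⟨K, hK⟩ := (ENNReal.tendsto_nhds_zero.1 (tendsto_measure_cdfGiven_tail P
    (show 0 < ε / (6 * C) by positivity)) (η / 2) hη2).exists
  obtain ⟨m, t, ht, ht0, htm, hosc⟩ := exists_grid hf (Nat.cast_nonneg K)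
    (show 0 < ε / 6 by positivity)
  have hsum := TendstoZeroInLaw.sum
    (fun j => (tendstoZeroInLaw_rightLim_sub_cdfGiven (P := P) he hh (t j)).abs) (m + 1)
    (ε / (12 * C)) (by positivity)
  let tail : Set (X × ℝ) := {v | ε / (6 * C) ≤ 1 - (cdfGiven P K v - cdfGiven P (-K) v)}
  let dev : ∀ n, Set ((Fin n → ExtObs X) × ExtObs X × unitInterval) := fun n =>
    {p | ε / (12 * C) ≤ |∑ j ∈ Finset.range (m + 1), (|Function.rightLim (fun y : ℝ =>
      conformalTransducer (histogramConformityMeasure e h) n p.1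
        ((p.2.1.1.1, y), p.2.1.2) p.2.2) (t j) - cdfGiven P (t j) p.2.1.1|)|}
  filter_upwards [ENNReal.tendsto_nhds_zero.1 hsum (η / 2) hη2] with n hn
  have hae : ∀ᵐ p ∂law P n, condExpGivenPredictor P f p.2.1.1
      = ∫ y, f y ∂(ProbabilityTheory.condDistrib Prod.snd Prod.fst P p.2.1.1.1) :=
    (measurePreserving_law_test P n).quasiMeasurePreserving.ae
      (condExpGivenPredictor_ae_eq P hf hC)
  refine le_trans (b := law P n ({p | p.2.1.1 ∈ tail} ∪ dev n)) (measure_mono_ae ?_)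
    ((measure_union_le _ _).trans ((add_le_add ((law_test_le n tail).trans hK) hn).trans_eq
      (ENNReal.add_halves η)))
  filter_upwards [hae] with p hp hmem
  replace hmem : ε ≤ |(∫ y, f y ∂predictiveMeasure fun y => conformalTransducer
    (histogramConformityMeasure e h) n p.1 ((p.2.1.1.1, y), p.2.1.2) p.2.2)
      - condExpGivenPredictor P f p.2.1.1| := hmem
  rw [hp] at hmem
  by_contra hcon
  obtain ⟨hcon1, hcon2⟩ := not_or.1 hcon
  replace hcon1 : 1 - (cdfGiven P K p.2.1.1 - cdfGiven P (-K) p.2.1.1) < ε / (6 * C) :=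
    not_le.1 hcon1
  replace hcon2 : ∑ j ∈ Finset.range (m + 1), (|Function.rightLim (fun y : ℝ =>
      conformalTransducer (histogramConformityMeasure e h) n p.1
        ((p.2.1.1.1, y), p.2.1.2) p.2.2) (t j) - cdfGiven P (t j) p.2.1.1|) < ε / (12 * C) :=
    lt_of_not_ge fun hge => hcon2 (le_trans hge (le_abs_self _))
  have hbound := abs_integral_predictiveMeasure_sub_le (P := P)
    (monotone_conformalTransducer_histogram e (hh.pos n) p.1 p.2.1.1.1 p.2.1.2 p.2.2)
    (fun y => smoothedRank_mem_Icc _ _ p.2.2.2) p.2.1.1 hf hC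
    (show 0 ≤ ε / 6 by positivity) ht hosc
  rw [ht0, htm] at hbound
  rw [lt_div_iff₀ (by positivity)] at hcon1 hcon2
  linarith [hmem.trans hbound]

/-- The width `2 ^ (-⌊log₄ n⌋)` is of order `n ^ (-1/2)`, and `4 ^ ⌊log₄ n⌋ ≤ n` gives `n h_n ≥ 2 ^
⌊log₄ n⌋` for `n ≠ 0`. -/
theorem exists_isBandwidth : ∃ h : ℕ → ℝ, IsBandwidth h := by
  have hlog : Tendsto (fun n : ℕ => Nat.log 4 n) atTop atTop :=
    tendsto_atTop_atTop.2 fun b => ⟨4 ^ b, fun n hn => Nat.le_log_of_pow_le (by norm_num) hn⟩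
  have hpow : Tendsto (fun n : ℕ => (2 : ℝ) ^ Nat.log 4 n) atTop atTop :=
    (tendsto_pow_atTop_atTop_of_one_lt one_lt_two).comp hlog
  refine ⟨fun n => ((2 : ℝ) ^ Nat.log 4 n)⁻¹, fun m n hmn => ?_, fun n => ⟨-(Nat.log 4 n : ℤ), ?_⟩,
    hpow.inv_tendsto_atTop, ?_⟩
  · have := Nat.log_mono_right (b := 4) hmn
    change ((2 : ℝ) ^ Nat.log 4 n)⁻¹ ≤ ((2 : ℝ) ^ Nat.log 4 m)⁻¹
    gcongr
    exact one_le_two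
  · rw [zpow_neg, zpow_natCast]
  · refine tendsto_atTop_mono' _ ?_ hpow
    filter_upwards [eventually_ne_atTop 0] with n hn
    rw [← div_eq_mul_inv, le_div_iff₀ (by positivity), ← mul_pow]
    have : 4 ^ Nat.log 4 n ≤ n := Nat.pow_log_le_self 4 hn
    norm_num
    exact_mod_cast this

theorem isConformalPredictiveSystem_histogram (he : Measurable e) (hh : IsBandwidth h) :
    IsConformalPredictiveSystem (conformalTransducer (histogramConformityMeasure e h)) :=
  ⟨⟨_, isRandomizedConformityMeasure_histogram he hh, fun _ _ => rfl⟩,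
    isRandomizedPredictiveSystem_histogram he hh⟩

end ConformalPrediction

theorem mainTheorem1 {X : Type*} [MeasurableSpace X] [StandardBorelSpace X] :
    (∃ Q : (n : ℕ) → (Fin n → ConformalPrediction.ExtObs X) → ConformalPrediction.ExtObs X →
        unitInterval → ℝ,
      ConformalPrediction.IsConformalPredictiveSystem Q ∧
        ConformalPrediction.IsUniversallyConsistent Q) ∧
    ∀ (e : X → ℝ) (h : ℕ → ℝ), MeasurableEmbedding e → ConformalPrediction.IsBandwidth h →
      ConformalPrediction.IsRandomizedConformityMeasure
        (ConformalPrediction.histogramConformityMeasure e h) ∧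
      ConformalPrediction.IsConformalPredictiveSystem
        (ConformalPrediction.conformalTransducer
          (ConformalPrediction.histogramConformityMeasure e h)) ∧
      ConformalPrediction.IsUniversallyConsistent
        (ConformalPrediction.conformalTransducer
          (ConformalPrediction.histogramConformityMeasure e h)) := by
  refine ⟨?_, fun e h he hh =>
    ⟨ConformalPrediction.isRandomizedConformityMeasure_histogram he.measurable hh,
      ConformalPrediction.isConformalPredictiveSystem_histogram he.measurable hh,
      ConformalPrediction.isUniversallyConsistent_histogram he hh⟩⟩
  obtain ⟨e, he⟩ := exists_measurableEmbedding_real X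
  obtain ⟨h, hh⟩ := ConformalPrediction.exists_isBandwidth
  exact ⟨_, ConformalPrediction.isConformalPredictiveSystem_histogram he.measurable hh,
    ConformalPrediction.isUniversallyConsistent_histogram he hh⟩
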